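/- Let $n\ge 1$, let $K\subset\mathbb{R}^n$ be a closed convex set, let $\mu_0\in K$, and assume $K\neq\{\mu_0\}$. Let $Y=\mu_0+\xi$, where $\xi$ is an $n$-dimensional standard Gaussian vector (this is the model under $H_0$), and write $\mathbb{P}_{\mu_0},\mathbb{E}_{\mu_0},\mathrm{Var}_{\mu_0}$ for probability, expectation and variance under this model. Let $\|\cdot\|$ be the Euclidean norm, let $\Pi_K(y)=\arg\min_{\nu\in K}\|y-\nu\|^2$ be the metric projection onto $K$, let $\hat\mu_K=\Pi_K(Y)$, and let $$T(Y)=\|Y-\mu_0\|^2-\|Y-\hat\mu_K\|^2$$ be the log-likelihood ratio statistic, with $m_{\mu_0}=\mathbb{E}_{\mu_0}T(Y)$ and $\sigma_{\mu_0}=\sqrt{\mathrm{Var}_{\mu_0}(T(Y))}$. Let $J_{\hat\mu_K}=J_{\Pi_K}(\mu_0+\xi)$, where $J_{\Pi_K}(z)=(\partial(\Pi_K)_i(z)/\partial z_j)_{i,j=1}^n$ is the Jacobian of $\Pi_K$, which exists for Lebesgue-almost every $z$; let $\|\cdot\|_F$ be the Frobenius norm, and let $\mathbb{E}_{\mu_0}J_{\hat\mu_K}$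 be the entrywise expectation. Then $$d_{\mathrm{TV}}\left(\frac{T(Y)-m_{\mu_0}}{\sigma_{\mu_0}},\,\mathcal{N}(0,1)\right)\le \frac{8\sqrt{\mathbb{E}_{\mu_0}\|\hat\mu_K-\mu_0\|^2}}{2\|\mathbb{E}_{\mu_0}\hat\mu_K-\mu_0\|^2+\|\mathbb{E}_{\mu_0}J_{\hat\mu_K}\|_F^2},$$ where $d_{\mathrm{TV}}(X,Z)=\sup_{B}|\mathbb{P}(X\in B)-\mathbb{P}(Z\in B)|$, the supremum being over all Borel sets $B\subset\mathbb{R}$. -/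

import Mathlib

open MeasureTheory ProbabilityTheory

noncomputable section

namespace LRT

/-- The metric projection `Π_K(x) = argmin_{ν ∈ K} ‖x - ν‖²` onto a set `K ⊆ ℝⁿ`: the chosen
minimizer. For `K` nonempty, closed and convex it exists and is unique, see
`metricProj_isArgmin` and `eq_metricProj`. -/
def metricProj {n : ℕ} (K : Set (EuclideanSpace ℝ (Fin n))) (x : EuclideanSpace ℝ (Fin n)) :
    EuclideanSpace ℝ (Fin n) :=
  Classical.epsilon fun y => y ∈ K ∧ IsMinOn (fun ν => ‖x - ν‖ ^ 2) K y

theorem metricProj_isArgmin {n : ℕ} {K : Set (EuclideanSpace ℝ (Fin n))} (hne : K.Nonempty)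
    (hcl : IsClosed K) (x : EuclideanSpace ℝ (Fin n)) :
    metricProj K x ∈ K ∧ IsMinOn (fun ν => ‖x - ν‖ ^ 2) K (metricProj K x) := by
  refine Classical.epsilon_spec (p := fun y => y ∈ K ∧ IsMinOn (fun ν => ‖x - ν‖ ^ 2) K y) ?_
  obtain ⟨y, hy, h⟩ := hcl.exists_infDist_eq_dist hne x
  refine ⟨y, hy, fun z hz => ?_⟩
  have h1 : ‖x - y‖ ≤ ‖x - z‖ := by
    rw [← dist_eq_norm, ← dist_eq_norm, ← h]
    exact Metric.infDist_le_dist_of_mem hz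
  change ‖x - y‖ ^ 2 ≤ ‖x - z‖ ^ 2
  gcongr

theorem eq_metricProj {n : ℕ} {K : Set (EuclideanSpace ℝ (Fin n))} (hcl : IsClosed K)
    (hcv : Convex ℝ K) {x y : EuclideanSpace ℝ (Fin n)} (hy : y ∈ K)
    (hmin : IsMinOn (fun ν => ‖x - ν‖ ^ 2) K y) : y = metricProj K x := by
  obtain ⟨hz, hzmin⟩ := metricProj_isArgmin ⟨y, hy⟩ hcl x
  set z := metricProj K x
  have h1 : ‖x - y‖ ^ 2 ≤ ‖x - z‖ ^ 2 := hmin hz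
  have hm : (1 / 2 : ℝ) • y + (1 / 2 : ℝ) • z ∈ K :=
    hcv hy hz (by norm_num) (by norm_num) (by norm_num)
  have h2 : ‖x - z‖ ^ 2 ≤ ‖x - ((1 / 2 : ℝ) • y + (1 / 2 : ℝ) • z)‖ ^ 2 := hzmin hm
  have h3 := parallelogram_law_with_norm ℝ (x - y) (x - z)
  have h4 : (x - y) + (x - z) = (2 : ℝ) • (x - ((1 / 2 : ℝ) • y + (1 / 2 : ℝ) • z)) := by
    module
  have h5 : (x - y) - (x - z) = z - y := by abel
  rw [h4, h5, norm_smul, Real.norm_ofNat] at h3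
  have h6 : ‖z - y‖ ^ 2 ≤ 0 := by nlinarith
  have h7 : ‖z - y‖ = 0 := by nlinarith [norm_nonneg (z - y)]
  exact (sub_eq_zero.mp (norm_eq_zero.mp h7)).symm

/-- The log-likelihood ratio statistic `T(y) = ‖y - μ₀‖² - ‖y - Π_K(y)‖²`. -/
def lrs {n : ℕ} (K : Set (EuclideanSpace ℝ (Fin n))) (μ₀ y : EuclideanSpace ℝ (Fin n)) : ℝ :=
  ‖y - μ₀‖ ^ 2 - ‖y - metricProj K y‖ ^ 2

/-- The Jacobian matrix `J_f(z) = (∂f_i(z)/∂z_j)_{i,j}`. -/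
def jacobian {n : ℕ} (f : EuclideanSpace ℝ (Fin n) → EuclideanSpace ℝ (Fin n))
    (z : EuclideanSpace ℝ (Fin n)) : Matrix (Fin n) (Fin n) ℝ :=
  Matrix.of fun i j => lineDeriv ℝ (fun y => f y i) z (EuclideanSpace.single j 1)

/-- The entrywise expectation of a random matrix. -/
def matrixExpectation {Ω : Type*} [MeasurableSpace Ω] (P : Measure Ω) {n : ℕ}
    (M : Ω → Matrix (Fin n) (Fin n) ℝ) : Matrix (Fin n) (Fin n) ℝ :=
  Matrix.of fun i j => ∫ ω, M ω i j ∂P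

/-- The Frobenius norm of a real matrix. -/
def frobeniusNorm {n : ℕ} (M : Matrix (Fin n) (Fin n) ℝ) : ℝ :=
  √(∑ i, ∑ j, M i j ^ 2)

/-- The total variation distance `sup_B |α(B) - β(B)|` over all Borel sets `B ⊆ ℝ`
(for probability measures the supremum is over a set of numbers in `[0, 1]`). -/
def tvDist (α β : Measure ℝ) : ℝ :=
  ⨆ B : {B : Set ℝ // MeasurableSet B}, |α.real B - β.real B|

end LRT

end

/-! Write `p x = Π_K (μ₀ + x) - μ₀` and `F x = T (μ₀ + x)` for a standard Gaussian `x`. Since `F` is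
a supremum over `K` of affine functions, attained at the projection, it is differentiable with
gradient `2 p`, and `p` is 1-Lipschitz. Hence `F` has one Lipschitz derivative and the second-order
Poincaré method applies.

Upper bound: the covariance identity `Cov (g, F) = E ⟪∇g, rotAverage ∇F⟫` makes `G = ⟪∇F, rotAverage
∇F⟫ = 4 ⟪p, rotAverage p⟫` a Stein kernel of `F`, with `E G = σ²`. If `f` solves Stein's equation
for a test function with values in `[0, 1]`, then `|f'| ≤ 2` and the error equals `E [f' (W) (σ² -
G)] / σ²`, which is at most `2 √(Var G) / σ²`. As `p` and `rotAverage p` are Lipschitz, `∇G` is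
controlled by their norms, and `LipGrowth.variance_le` gives `Var G ≤ 64 E ‖p‖²`. The error is
therefore at most `16 √(E ‖p‖²) / σ²`.

Lower bound: let `D` be the denominator of the claim. Bessel's inequality for the first two Wiener
chaoses bounds `σ²` below by `‖E ∇F‖² + ‖E ∇²F‖_F² / 2 = 4 ‖E p‖² + 2 ‖E J‖_F² = 2 D`. The second
derivative exists only almost everywhere, so its expectation is handled by Stein's lemma for
Lipschitz functions. Dividing gives the constant 8; `K ≠ {μ₀}` ensures `D > 0`. -/

noncomputable section

namespace LRT

open Real Set Filter Topology
open scoped ENNReal NNReal RealInnerProductSpace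

/-! ### Polynomial growth and measures with all moments -/

section Growth

variable {X Y Z : Type*} [NormedAddCommGroup X] [NormedAddCommGroup Y] [NormedAddCommGroup Z]

/-- A function has polynomial growth if its norm is at most `C * (1 + ‖x‖) ^ k`. -/
@[fun_prop]
def PolyGrowth (f : X → Y) : Prop :=
  ∃ C : ℝ, 0 ≤ C ∧ ∃ k : ℕ, ∀ x, ‖f x‖ ≤ C * (1 + ‖x‖) ^ k

theorem PolyGrowth.of_norm_le {f : X → Y} {g : X → Z} (hg : PolyGrowth g)
    (h : ∀ x, ‖f x‖ ≤ ‖g x‖) : PolyGrowth f := by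
  obtain ⟨C, hC, k, hk⟩ := hg
  exact ⟨C, hC, k, fun x => (h x).trans (hk x)⟩

@[fun_prop]
theorem PolyGrowth.id : PolyGrowth fun x : X => x :=
  ⟨1, zero_le_one, 1, fun x => by simp⟩

@[fun_prop]
theorem PolyGrowth.const (c : Y) : PolyGrowth fun _ : X => c :=
  ⟨‖c‖, norm_nonneg c, 0, fun x => by simp⟩

@[fun_prop]
theorem PolyGrowth.comp {g : Y → Z} {f : X → Y} (hg : PolyGrowth g) (hf : PolyGrowth f) :
    PolyGrowth fun x => g (f x) := by
  obtain ⟨C, hC, k, hk⟩ := hf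
  obtain ⟨D, hD, l, hl⟩ := hg
  refine ⟨D * (1 + C) ^ l, by positivity, k * l, fun x => (hl _).trans ?_⟩
  rw [mul_assoc, pow_mul, ← mul_pow]
  have h1 : 1 ≤ (1 + ‖x‖) ^ k := one_le_pow₀ (by simp)
  have := hk x
  gcongr
  nlinarith

@[fun_prop]
theorem PolyGrowth.norm {f : X → Y} (hf : PolyGrowth f) : PolyGrowth fun x => ‖f x‖ :=
  hf.of_norm_le fun x => by simp

@[fun_prop]
theorem PolyGrowth.add {f g : X → Y} (hf : PolyGrowth f) (hg : PolyGrowth g) :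
    PolyGrowth fun x => f x + g x := by
  obtain ⟨C, hC, k, hk⟩ := hf
  obtain ⟨D, hD, l, hl⟩ := hg
  refine ⟨C + D, by positivity, k + l, fun x => (norm_add_le _ _).trans ?_⟩
  have h0 : 1 ≤ 1 + ‖x‖ := by simp
  have h1 : (1 + ‖x‖) ^ k ≤ (1 + ‖x‖) ^ (k + l) := pow_le_pow_right₀ h0 (by simp)
  have h2 : (1 + ‖x‖) ^ l ≤ (1 + ‖x‖) ^ (k + l) := pow_le_pow_right₀ h0 (by simp)
  rw [add_mul]
  exact add_le_add ((hk x).trans (by gcongr)) ((hl x).trans (by gcongr))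

@[fun_prop]
theorem PolyGrowth.neg {f : X → Y} (hf : PolyGrowth f) : PolyGrowth fun x => -f x :=
  hf.of_norm_le fun x => by simp

@[fun_prop]
theorem PolyGrowth.sub {f g : X → Y} (hf : PolyGrowth f) (hg : PolyGrowth g) :
    PolyGrowth fun x => f x - g x := by
  simpa only [sub_eq_add_neg] using hf.add hg.neg

@[fun_prop]
theorem PolyGrowth.mul {f g : X → ℝ} (hf : PolyGrowth f) (hg : PolyGrowth g) :
    PolyGrowth fun x => f x * g x := by
  obtain ⟨C, hC, k, hk⟩ := hf
  obtain ⟨D, hD, l, hl⟩ := hg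
  refine ⟨C * D, by positivity, k + l, fun x => ?_⟩
  rw [norm_mul, pow_add]
  calc ‖f x‖ * ‖g x‖ ≤ (C * (1 + ‖x‖) ^ k) * (D * (1 + ‖x‖) ^ l) := by
        gcongr
        · exact hk x
        · exact hl x
    _ = _ := by ring

@[fun_prop]
theorem PolyGrowth.pow {f : X → ℝ} (hf : PolyGrowth f) (n : ℕ) :
    PolyGrowth fun x => f x ^ n := by
  induction n with
  | zero => simpa using PolyGrowth.const (X := X) (1 : ℝ)
  | succ n ih => simpa only [pow_succ] using ih.mul hf

@[fun_prop]
theorem PolyGrowth.smul [NormedSpace ℝ Y] {f : X → ℝ} {g : X → Y} (hf : PolyGrowth f)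
    (hg : PolyGrowth g) : PolyGrowth fun x => f x • g x :=
  (hf.mul hg.norm).of_norm_le fun x => by simp [norm_smul]

@[fun_prop]
theorem PolyGrowth.inner {E : Type*} [NormedAddCommGroup E] [InnerProductSpace ℝ E]
    {f g : X → E} (hf : PolyGrowth f) (hg : PolyGrowth g) :
    PolyGrowth fun x => ⟪f x, g x⟫ :=
  (hf.norm.mul hg.norm).of_norm_le fun x => by
    simpa using abs_real_inner_le_norm (f x) (g x)

@[fun_prop]
theorem PolyGrowth.prodMk {f : X → Y} {g : X → Z} (hf : PolyGrowth f) (hg : PolyGrowth g) :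
    PolyGrowth fun x => (f x, g x) :=
  (hf.norm.add hg.norm).of_norm_le fun x => by
    rw [Prod.norm_def, Real.norm_of_nonneg (by positivity)]
    exact max_le_add_of_nonneg (norm_nonneg _) (norm_nonneg _)

@[fun_prop]
theorem PolyGrowth.fst {f : X → Y × Z} (hf : PolyGrowth f) : PolyGrowth fun x => (f x).1 :=
  hf.of_norm_le fun x => norm_fst_le (f x)

@[fun_prop]
theorem PolyGrowth.snd {f : X → Y × Z} (hf : PolyGrowth f) : PolyGrowth fun x => (f x).2 :=
  hf.of_norm_le fun x => norm_snd_le (f x)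

@[fun_prop]
theorem PolyGrowth.sin (f : X → ℝ) : PolyGrowth fun x => Real.sin (f x) :=
  (PolyGrowth.const (1 : ℝ)).of_norm_le fun x => by simpa using Real.abs_sin_le_one (f x)

@[fun_prop]
theorem PolyGrowth.cos (f : X → ℝ) : PolyGrowth fun x => Real.cos (f x) :=
  (PolyGrowth.const (1 : ℝ)).of_norm_le fun x => by simpa using Real.abs_cos_le_one (f x)

theorem PolyGrowth.of_lipschitzWith {f : X → Y} {C : ℝ≥0} (hf : LipschitzWith C f) :
    PolyGrowth f := by
  refine ⟨C + ‖f 0‖, by positivity, 1, fun x => ?_⟩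
  have h := hf.norm_sub_le x 0
  have h2 := norm_le_norm_add_norm_sub' (f x) (f 0)
  rw [sub_zero] at h
  nlinarith [norm_nonneg x, norm_nonneg (f 0), C.coe_nonneg]

@[fun_prop]
theorem PolyGrowth.euclidean_apply {ι : Type*} [Fintype ι] {f : X → EuclideanSpace ℝ ι}
    (hf : PolyGrowth f) (i : ι) : PolyGrowth fun x => f x i :=
  hf.of_norm_le fun x => PiLp.norm_apply_le (f x) i

/-- All moments of the measure are finite. -/
class AllMoments [MeasurableSpace X] (μ : Measure X) : Prop where
  integrable_pow (μ) : ∀ k : ℕ, Integrable (fun x => (1 + ‖x‖) ^ k) μ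

theorem PolyGrowth.integrable [MeasurableSpace X] {μ : Measure X} [AllMoments μ] {f : X → Y}
    (hf : PolyGrowth f) (hm : AEStronglyMeasurable f μ) : Integrable f μ := by
  obtain ⟨C, hC, k, hk⟩ := hf
  exact ((AllMoments.integrable_pow μ k).const_mul C).mono' hm (Eventually.of_forall hk)

/-- The integrability device for most integrands below: both hypotheses are closed under the usual
operations, so `fun_prop` discharges them. -/
theorem PolyGrowth.integrable_of_continuous [MeasurableSpace X] [OpensMeasurableSpace X]
    [SecondCountableTopologyEither X Y]
    {μ : Measure X} [AllMoments μ] {f : X → Y} (hf : PolyGrowth f) (hc : Continuous f) :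
    Integrable f μ :=
  hf.integrable hc.aestronglyMeasurable

theorem PolyGrowth.memLp_two [MeasurableSpace X] {μ : Measure X} [AllMoments μ] {f : X → ℝ}
    (hf : PolyGrowth f) (hm : AEStronglyMeasurable f μ) : MemLp f 2 μ :=
  (memLp_two_iff_integrable_sq hm).2 ((hf.pow 2).integrable (hm.pow 2))

instance AllMoments.isFiniteMeasure [MeasurableSpace X] (μ : Measure X) [AllMoments μ] :
    IsFiniteMeasure μ := by
  have := AllMoments.integrable_pow μ 0
  simpa [integrable_const_iff_isFiniteMeasure] using this

instance AllMoments.of_isGaussian [MeasurableSpace X] [NormedSpace ℝ X] [CompleteSpace X]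
    [BorelSpace X] [SecondCountableTopology X] (μ : Measure X) [IsGaussian μ] : AllMoments μ where
  integrable_pow k := by
    have h1 : MemLp (fun x : X => 1 + ‖x‖) (k : ℝ≥0∞) μ :=
      (memLp_const (1 : ℝ)).add (IsGaussian.memLp_id μ k (by simp)).norm
    have h2 := h1.integrable_norm_pow'
    refine h2.congr (Eventually.of_forall fun x => ?_)
    simp only
    rw [Real.norm_of_nonneg (by positivity)]

instance AllMoments.prod [MeasurableSpace X] [MeasurableSpace Y] [OpensMeasurableSpace X]
    [OpensMeasurableSpace Y] (μ : Measure X) (ν : Measure Y) [AllMoments μ]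
    [AllMoments ν] : AllMoments (μ.prod ν) where
  integrable_pow k := by
    refine ((AllMoments.integrable_pow μ k).mul_prod (AllMoments.integrable_pow ν k)).mono'
      (Measurable.aestronglyMeasurable ?_) (Eventually.of_forall fun z => ?_)
    · simp only [Prod.norm_def]
      fun_prop
    · rw [Real.norm_of_nonneg (by positivity), ← mul_pow]
      gcongr
      rw [Prod.norm_def]
      have h1 := norm_nonneg z.1
      have h2 := norm_nonneg z.2
      rcases max_cases ‖z.1‖ ‖z.2‖ with h | h <;> rw [h.1] <;> nlinarith

instance AllMoments.restrict_Ioc (a b : ℝ) : AllMoments (volume.restrict (Ioc a b)) where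
  integrable_pow k := by
    have : Continuous fun x : ℝ => (1 + ‖x‖) ^ k := by fun_prop
    exact this.integrableOn_Ioc

end Growth

/-! ### The density of the standard Gaussian measure and integration by parts -/

section Density

variable {E : Type*} [NormedAddCommGroup E] [InnerProductSpace ℝ E]

variable (E) in
/-- The density of the standard Gaussian measure. -/
def gaussDensity (x : E) : ℝ :=
  (2 * π) ^ (-(Module.finrank ℝ E / 2 : ℝ)) * rexp (-(1 / 2) * ‖x‖ ^ 2)

theorem gaussDensity_pos (x : E) : 0 < gaussDensity E x := by
  unfold gaussDensity; positivity

theorem continuous_gaussDensity : Continuous (gaussDensity E) := by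
  unfold gaussDensity; fun_prop

theorem hasFDerivAt_gaussDensity (x : E) :
    HasFDerivAt (gaussDensity E) (-(gaussDensity E x) • innerSL ℝ x) x := by
  have h := (((hasStrictFDerivAt_norm_sq x).hasFDerivAt.const_mul (-(1 / 2) : ℝ)).exp).const_mul
    ((2 * π) ^ (-(Module.finrank ℝ E / 2 : ℝ)))
  refine h.congr_fderiv ?_
  ext v
  simp [gaussDensity]
  ring

variable [FiniteDimensional ℝ E] [MeasurableSpace E] [BorelSpace E]

theorem integrable_gaussDensity : Integrable (gaussDensity E) := by
  unfold gaussDensity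
  refine Integrable.const_mul ?_ _
  have h := GaussianFourier.integrable_cexp_neg_mul_sq_norm_add (V := E) (b := 1 / 2)
    (by norm_num) 0 0
  refine h.norm.congr (Eventually.of_forall fun x => ?_)
  simp only [Complex.norm_exp]
  congr 1
  simp [← Complex.ofReal_pow]

/-- Both measures are finite, so equality of characteristic functions suffices, and that of the
density is a Gaussian Fourier integral. The density gives access to integration by parts and to
Rademacher's theorem for Lebesgue measure. -/
theorem stdGaussian_eq_withDensity :
    stdGaussian E = volume.withDensity fun x => ENNReal.ofReal (gaussDensity E x) := by
  have hfin : IsFiniteMeasure (volume.withDensity fun x => ENNReal.ofReal (gaussDensity E x)) :=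
    isFiniteMeasure_withDensity_ofReal integrable_gaussDensity.2
  refine Measure.ext_of_charFun ?_
  ext t
  rw [charFun_stdGaussian, charFun_apply, integral_withDensity_eq_integral_toReal_smul
    (by have := continuous_gaussDensity (E := E); fun_prop) (by simp)]
  have h := GaussianFourier.integral_cexp_neg_mul_sq_norm_add (V := E) (b := 1 / 2)
    (by norm_num) Complex.I t
  have h2 : ∀ x : E, (ENNReal.ofReal (gaussDensity E x)).toReal • Complex.exp (⟪x, t⟫ * Complex.I)
      = ((2 * π) ^ (-(Module.finrank ℝ E / 2 : ℝ)) : ℝ) *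
        Complex.exp (-(1 / 2) * ‖x‖ ^ 2 + Complex.I * ⟪t, x⟫) := by
    intro x
    rw [ENNReal.toReal_ofReal (gaussDensity_pos x).le, Complex.real_smul, gaussDensity,
      Complex.ofReal_mul, Complex.exp_add, real_inner_comm, mul_comm Complex.I, mul_assoc]
    norm_num
  simp_rw [h2]
  rw [integral_const_mul, h]
  have h3 : ((π / (1 / 2) : ℂ)) ^ (Module.finrank ℝ E / 2 : ℂ) =
      (((2 * π) ^ (Module.finrank ℝ E / 2 : ℝ) : ℝ) : ℂ) := by
    rw [Complex.ofReal_cpow (by positivity)]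
    push_cast
    congr 1
    field_simp
  rw [h3, ← mul_assoc, ← Complex.ofReal_mul, ← Real.rpow_add (by positivity)]
  simp only [neg_add_cancel, rpow_zero, Complex.ofReal_one, one_mul, Complex.I_sq]
  congr 1
  ring

theorem stdGaussian_absolutelyContinuous : stdGaussian E ≪ volume := by
  rw [stdGaussian_eq_withDensity]
  exact withDensity_absolutelyContinuous _ _

instance isOpenPosMeasure_stdGaussian : (stdGaussian E).IsOpenPosMeasure := by
  rw [stdGaussian_eq_withDensity]
  refine (withDensity_absolutelyContinuous' ?_ ?_).isOpenPosMeasure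
  · have := continuous_gaussDensity (E := E)
    fun_prop
  · exact Eventually.of_forall fun x => by simp [gaussDensity_pos]

theorem integrable_stdGaussian_iff {f : E → ℝ} :
    Integrable f (stdGaussian E) ↔ Integrable fun x => f x * gaussDensity E x := by
  rw [stdGaussian_eq_withDensity, integrable_withDensity_iff
    (by have := continuous_gaussDensity (E := E); fun_prop) (by simp)]
  simp [ENNReal.toReal_ofReal (gaussDensity_pos _).le]

theorem integral_stdGaussian (f : E → ℝ) :
    ∫ x, f x ∂stdGaussian E = ∫ x, f x * gaussDensity E x := by
  rw [stdGaussian_eq_withDensity, integral_withDensity_eq_integral_toReal_smul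
    (by have := continuous_gaussDensity (E := E); fun_prop) (by simp)]
  simp [ENNReal.toReal_ofReal (gaussDensity_pos _).le, mul_comm]

/-- **Stein's lemma**: Gaussian integration by parts in the direction `v`. -/
theorem integral_mul_inner_stdGaussian {f f' : E → ℝ} {v : E}
    (hf : ∀ x, HasLineDerivAt ℝ f (f' x) x v) (hfi : Integrable f (stdGaussian E))
    (hf'i : Integrable f' (stdGaussian E))
    (hfv : Integrable (fun x => f x * ⟪x, v⟫) (stdGaussian E)) :
    ∫ x, f x * ⟪x, v⟫ ∂stdGaussian E = ∫ x, f' x ∂stdGaussian E := by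
  have hg : ∀ x : E, HasLineDerivAt ℝ (gaussDensity E) (-(⟪x, v⟫ * gaussDensity E x)) x v := by
    intro x
    have := (hasFDerivAt_gaussDensity x).hasLineDerivAt v
    simpa [mul_comm] using this
  rw [integrable_stdGaussian_iff] at hfi hf'i hfv
  -- Lebesgue integration by parts against the density, whose derivative along `v` is `-⟪x, v⟫`
  -- times itself.
  have h := integral_bilinear_hasLineDerivAt_right_eq_neg_left_of_integrable (μ := volume)
    (B := ContinuousLinearMap.mul ℝ ℝ) (f := f) (f' := f') (g := gaussDensity E)
    (g' := fun x => -(⟪x, v⟫ * gaussDensity E x)) (v := v)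
    (by simpa using hf'i) (by simpa [mul_assoc] using hfv.neg) (by simpa using hfi)
    (fun x _ => hf x) (fun x _ => hg x)
  simp only [ContinuousLinearMap.mul_apply', mul_neg, integral_neg, neg_inj] at h
  rw [integral_stdGaussian, integral_stdGaussian, ← h]
  simp only [mul_assoc]

/-- Gaussian integration by parts for functions of polynomial growth. -/
theorem integral_mul_inner_stdGaussian_of_polyGrowth {f : E → ℝ} {f' : E → E}
    (hf : ∀ x, HasGradientAt f (f' x) x) (hfg : PolyGrowth f) (hf'c : Continuous f')
    (hf'g : PolyGrowth f') (v : E) :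
    ∫ x, f x * ⟪x, v⟫ ∂stdGaussian E = ∫ x, ⟪f' x, v⟫ ∂stdGaussian E := by
  have hfc : Continuous f := continuous_iff_continuousAt.2 fun x => (hf x).continuousAt
  refine integral_mul_inner_stdGaussian (fun x => ?_)
    (PolyGrowth.integrable_of_continuous (by fun_prop) (by fun_prop))
    (PolyGrowth.integrable_of_continuous (by fun_prop) (by fun_prop))
    (PolyGrowth.integrable_of_continuous (by fun_prop) (by fun_prop))
  simpa using (hf x).hasFDerivAt.hasLineDerivAt v

end Density

/-! ### Rotations and the Gaussian covariance identity -/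

section Covariance

theorem measurePreserving_prod_left_comm {X Y Z : Type*} [MeasurableSpace X] [MeasurableSpace Y]
    [MeasurableSpace Z] (μ : Measure X) (ν : Measure Y) (ρ : Measure Z) [SFinite μ] [SFinite ν]
    [SFinite ρ] : MeasurePreserving (fun w : X × Y × Z => (w.2.1, w.1, w.2.2))
      (μ.prod (ν.prod ρ)) (ν.prod (μ.prod ρ)) :=
  ((measurePreserving_prodAssoc _ _ _).comp
    ((Measure.measurePreserving_swap (μ := μ) (ν := ν)).prod (MeasurePreserving.id ρ))).comp
    ((measurePreserving_prodAssoc μ ν ρ).symm _)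

variable {E : Type*} [NormedAddCommGroup E] [InnerProductSpace ℝ E] [FiniteDimensional ℝ E]

theorem hasDerivAt_rotation {F : E → ℝ} {F' : E → E} (hF : ∀ x, HasGradientAt F (F' x) x)
    (x y : E) (θ : ℝ) :
    HasDerivAt (fun θ : ℝ => F (cos θ • x + sin θ • y))
      ⟪F' (cos θ • x + sin θ • y), -sin θ • x + cos θ • y⟫ θ := by
  have h1 : HasDerivAt (fun θ : ℝ => cos θ • x + sin θ • y) (-sin θ • x + cos θ • y) θ :=
    ((hasDerivAt_cos θ).smul_const x).add ((hasDerivAt_sin θ).smul_const y)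
  exact ((hF _).hasFDerivAt.comp_hasDerivAt θ h1).congr_deriv (by simp)

/-- Join `x` to `y` by the arc `cos θ • x + sin θ • y`, not by a segment: for independent standard
Gaussians, position and velocity on the arc are again independent standard Gaussians. -/
theorem sub_eq_integral_rotation {F : E → ℝ} {F' : E → E}
    (hF : ∀ x, HasGradientAt F (F' x) x) (hF'c : Continuous F') (x y : E) :
    F x - F y = ∫ θ in Ioc 0 (π / 2),
      ⟪F' (cos θ • x + sin θ • y), sin θ • x - cos θ • y⟫ := by
  rw [← intervalIntegral.integral_of_le (by positivity)]
  have h := intervalIntegral.integral_eq_sub_of_hasDerivAt (a := 0) (b := π / 2)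
    (fun θ _ => (hasDerivAt_rotation hF x y θ).neg)
    (Continuous.intervalIntegrable (by fun_prop) _ _)
  simp only [cos_pi_div_two, zero_smul, sin_pi_div_two, one_smul, zero_add, cos_zero, sin_zero,
    add_zero, Pi.neg_apply, sub_neg_eq_add, neg_add_eq_sub] at h
  rw [← h]
  congr 1 with θ
  rw [← inner_neg_right]
  congr 1
  module

variable [MeasurableSpace E] [BorelSpace E]

theorem measurePreserving_rotation (θ : ℝ) :
    MeasurePreserving (fun z : E × E => (cos θ • z.1 + sin θ • z.2, -sin θ • z.1 + cos θ • z.2))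
      ((stdGaussian E).prod (stdGaussian E)) ((stdGaussian E).prod (stdGaussian E)) := by
  refine ⟨by fun_prop, ?_⟩
  have h := IsGaussian.map_rotation_eq_self (μ := stdGaussian E) (by simp) θ
  exact h

theorem measurePreserving_cos_smul_add_sin_smul (θ : ℝ) :
    MeasurePreserving (fun z : E × E => cos θ • z.1 + sin θ • z.2)
      ((stdGaussian E).prod (stdGaussian E)) (stdGaussian E) :=
  measurePreserving_fst.comp (measurePreserving_rotation θ)

theorem integral_rotation {G : Type*} [NormedAddCommGroup G] [NormedSpace ℝ G] (θ : ℝ)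
    {f : E × E → G}
    (hf : AEStronglyMeasurable f ((stdGaussian E).prod (stdGaussian E))) :
    ∫ z, f (cos θ • z.1 + sin θ • z.2, -sin θ • z.1 + cos θ • z.2)
      ∂(stdGaussian E).prod (stdGaussian E) = ∫ z, f z ∂(stdGaussian E).prod (stdGaussian E) := by
  have h := measurePreserving_rotation (E := E) θ
  rw [← h.map_eq] at hf
  rw [← integral_map h.measurable.aemeasurable hf, h.map_eq]

/-- The law of the random angle: density `sin θ` on `(0, π / 2]`. -/
def angleMeasure : Measure ℝ :=
  (volume.restrict (Ioc 0 (π / 2))).withDensity fun θ => ENNReal.ofReal (sin θ)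

theorem integral_angleMeasure (f : ℝ → ℝ) :
    ∫ θ, f θ ∂angleMeasure = ∫ θ in Ioc 0 (π / 2), sin θ * f θ := by
  rw [angleMeasure, integral_withDensity_eq_integral_toReal_smul (by fun_prop) (by simp)]
  refine setIntegral_congr_fun measurableSet_Ioc fun θ hθ => ?_
  simp only [smul_eq_mul]
  rw [ENNReal.toReal_ofReal (sin_nonneg_of_nonneg_of_le_pi hθ.1.le
    (hθ.2.trans (by linarith [pi_pos])))]

instance isProbabilityMeasure_angleMeasure : IsProbabilityMeasure angleMeasure := by
  have hi : Integrable sin (volume.restrict (Ioc 0 (π / 2))) :=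
    continuous_sin.integrableOn_Ioc
  have hnn : 0 ≤ᵐ[volume.restrict (Ioc 0 (π / 2))] sin := by
    filter_upwards [ae_restrict_mem measurableSet_Ioc] with θ hθ
    exact sin_nonneg_of_nonneg_of_le_pi hθ.1.le (hθ.2.trans (by linarith [pi_pos]))
  refine ⟨?_⟩
  rw [angleMeasure, withDensity_apply _ MeasurableSet.univ, Measure.restrict_univ,
    ← ofReal_integral_eq_lintegral_ofReal hi hnn,
    ← intervalIntegral.integral_of_le (by positivity), integral_sin]
  simp

theorem angleMeasure_le : angleMeasure ≤ volume.restrict (Ioc 0 (π / 2)) := by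
  calc angleMeasure ≤ (volume.restrict (Ioc 0 (π / 2))).withDensity 1 := by
        refine withDensity_mono (Eventually.of_forall fun θ => ?_)
        simpa using sin_le_one θ
    _ = _ := withDensity_one

instance allMoments_angleMeasure : AllMoments angleMeasure where
  integrable_pow k := (AllMoments.integrable_pow _ k).mono_measure angleMeasure_le

theorem integral_cos_angleMeasure : ∫ θ, cos θ ∂angleMeasure = 1 / 2 := by
  rw [integral_angleMeasure, ← intervalIntegral.integral_of_le (by positivity),
    integral_sin_mul_cos₁]
  simp

/-- The average of `f` over random rotations of the point `x`. -/
def rotAverage (f : E → E) (x : E) : E :=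
  ∫ q, f (cos q.1 • x + sin q.1 • q.2) ∂angleMeasure.prod (stdGaussian E)

/-- Integration by parts after a rotation by the angle `θ`. -/
theorem integral_mul_inner_rotation {F' g' : E → E} {g : E → ℝ}
    (hF'c : Continuous F') (hF'g : PolyGrowth F') (hg : ∀ x, HasGradientAt g (g' x) x)
    (hgg : PolyGrowth g) (hg'c : Continuous g') (hg'g : PolyGrowth g') (θ : ℝ) :
    ∫ z : E × E, g z.1 * ⟪F' (cos θ • z.1 + sin θ • z.2), sin θ • z.1 - cos θ • z.2⟫
        ∂(stdGaussian E).prod (stdGaussian E) =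
      sin θ * ∫ z : E × E, ⟪g' z.1, F' (cos θ • z.1 + sin θ • z.2)⟫
        ∂(stdGaussian E).prod (stdGaussian E) := by
  have hgc : Continuous g := continuous_iff_continuousAt.2 fun x => (hg x).continuousAt
  -- In rotated coordinates `(u, v)` the first point is `cos θ • u - sin θ • v` and the direction
  -- `sin θ • z.1 - cos θ • z.2` is `-v`, while `F'` sees only `u`. Stein's lemma in `v` with `u`
  -- frozen then produces the factor `sin θ` by the chain rule.
  have hrot : ∀ z : E × E, cos θ • (cos θ • z.1 + sin θ • z.2)
      - sin θ • (-sin θ • z.1 + cos θ • z.2) = z.1 := by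
    intro z
    have : z.1 = (sin θ ^ 2 + cos θ ^ 2) • z.1 := by simp
    conv_rhs => rw [this]
    module
  have h1 : ∀ u : E, ∫ v, -(g (cos θ • u - sin θ • v) * ⟪F' u, v⟫) ∂stdGaussian E =
      ∫ v, sin θ * ⟪g' (cos θ • u - sin θ • v), F' u⟫ ∂stdGaussian E := by
    intro u
    have hd : ∀ v, HasGradientAt (fun v => -g (cos θ • u - sin θ • v))
        (sin θ • g' (cos θ • u - sin θ • v)) v := by
      intro v
      have h2 : HasFDerivAt (fun v : E => cos θ • u - sin θ • v)
          (-(sin θ • ContinuousLinearMap.id ℝ E)) v := by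
        simpa using ((hasFDerivAt_id v).const_smul (sin θ)).const_sub (cos θ • u)
      rw [hasGradientAt_iff_hasFDerivAt]
      refine ((hg (cos θ • u - sin θ • v)).hasFDerivAt.comp v h2).neg.congr_fderiv ?_
      ext w
      simp
    have h3 := integral_mul_inner_stdGaussian_of_polyGrowth hd (by fun_prop) (by fun_prop)
      (by fun_prop) (F' u)
    simpa [inner_smul_left, real_inner_comm] using h3
  have h2 := integral_rotation (E := E) θ
    (f := fun z => -(g (cos θ • z.1 - sin θ • z.2) * ⟪F' z.1, z.2⟫))
    (Continuous.aestronglyMeasurable (by fun_prop))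
  have h3 := integral_rotation (E := E) θ
    (f := fun z => sin θ * ⟪g' (cos θ • z.1 - sin θ • z.2), F' z.1⟫)
    (Continuous.aestronglyMeasurable (by fun_prop))
  simp only [hrot] at h2 h3
  rw [← integral_const_mul, h3, integral_prod
    (fun z : E × E => sin θ * ⟪g' (cos θ • z.1 - sin θ • z.2), F' z.1⟫)
    (PolyGrowth.integrable_of_continuous (by fun_prop) (by fun_prop))]
  refine Eq.trans ?_ (integral_congr_ae (Eventually.of_forall h1))
  rw [← integral_prod (fun z : E × E => -(g (cos θ • z.1 - sin θ • z.2) * ⟪F' z.1, z.2⟫))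
    (PolyGrowth.integrable_of_continuous (by fun_prop) (by fun_prop)), ← h2]
  congr 1 with z
  rw [← mul_neg, ← inner_neg_right]
  congr 2
  module

/-- The Gaussian covariance identity. -/
theorem covariance_eq_integral_inner_rotAverage {F g : E → ℝ} {F' g' : E → E}
    (hF : ∀ x, HasGradientAt F (F' x) x) (hFg : PolyGrowth F) (hF'c : Continuous F')
    (hF'g : PolyGrowth F') (hg : ∀ x, HasGradientAt g (g' x) x)
    (hgg : PolyGrowth g) (hg'c : Continuous g') (hg'g : PolyGrowth g') :
    ∫ x, g x * F x ∂stdGaussian E - (∫ x, g x ∂stdGaussian E) * ∫ x, F x ∂stdGaussian E =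
      ∫ x, ⟪g' x, rotAverage F' x⟫ ∂stdGaussian E := by
  have hgc : Continuous g := continuous_iff_continuousAt.2 fun x => (hg x).continuousAt
  have hFc : Continuous F := continuous_iff_continuousAt.2 fun x => (hF x).continuousAt
  set γ := stdGaussian E
  -- The product of the means is realised by an independent copy of the Gaussian vector.
  have hB : ∫ x, g x * F x ∂γ - (∫ x, g x ∂γ) * ∫ x, F x ∂γ =
      ∫ z : E × E, g z.1 * (F z.1 - F z.2) ∂γ.prod γ := by
    simp only [mul_sub]
    rw [integral_sub (PolyGrowth.integrable_of_continuous (by fun_prop) (by fun_prop))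
      (PolyGrowth.integrable_of_continuous (by fun_prop) (by fun_prop)), integral_prod_mul,
      integral_fun_fst (fun x => g x * F x)]
    simp
  have hC : ∫ z : E × E, g z.1 * (F z.1 - F z.2) ∂γ.prod γ =
      ∫ θ in Ioc 0 (π / 2), ∫ z : E × E,
        g z.1 * ⟪F' (cos θ • z.1 + sin θ • z.2), sin θ • z.1 - cos θ • z.2⟫ ∂γ.prod γ := by
    simp_rw [sub_eq_integral_rotation hF hF'c, ← integral_const_mul]
    exact integral_integral_swap
      (f := fun (z : E × E) (θ : ℝ) =>
        g z.1 * ⟪F' (cos θ • z.1 + sin θ • z.2), sin θ • z.1 - cos θ • z.2⟫)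
      (PolyGrowth.integrable_of_continuous (by fun_prop) (by fun_prop))
  rw [hB, hC]
  simp_rw [γ, integral_mul_inner_rotation hF'c hF'g hg hgg hg'c hg'g]
  -- The factor `sin θ` becomes the density of `angleMeasure`.
  rw [← integral_angleMeasure, ← integral_prod (fun w : ℝ × E × E =>
    ⟪g' w.2.1, F' (cos w.1 • w.2.1 + sin w.1 • w.2.2)⟫)
    (PolyGrowth.integrable_of_continuous (by fun_prop) (by fun_prop))]
  rw [← (measurePreserving_prod_left_comm γ angleMeasure γ).map_eq, integral_map (by fun_prop)
    (Continuous.aestronglyMeasurable (by fun_prop)), integral_prod _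
    (PolyGrowth.integrable_of_continuous (by fun_prop) (by fun_prop))]
  congr 1 with x
  simp only [rotAverage]
  rw [← integral_inner (PolyGrowth.integrable_of_continuous (by fun_prop) (by fun_prop))]

end Covariance

/-! ### A Gaussian Poincaré inequality -/

/-- Cauchy–Schwarz against the constant 1, from the nonnegativity of `∫ (M f - I)²`. -/
theorem sq_integral_le {α : Type*} [MeasurableSpace α] {μ : Measure α} [IsFiniteMeasure μ]
    {f : α → ℝ} (hf : Integrable f μ) (hf2 : Integrable (fun x => f x ^ 2) μ) :
    (∫ x, f x ∂μ) ^ 2 ≤ μ.real univ * ∫ x, f x ^ 2 ∂μ := by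
  set M := μ.real univ
  set I := ∫ x, f x ∂μ
  have h : 0 ≤ ∫ x, (M * f x - I) ^ 2 ∂μ := integral_nonneg fun x => sq_nonneg _
  have h2 : ∫ x, (M * f x - I) ^ 2 ∂μ = M ^ 2 * ∫ x, f x ^ 2 ∂μ - 2 * M * I * I + M * I ^ 2 := by
    have h3 : ∀ x, (M * f x - I) ^ 2 = M ^ 2 * f x ^ 2 - 2 * M * I * f x + I ^ 2 := fun x => by ring
    simp_rw [h3]
    rw [integral_add (by exact (hf2.const_mul _).sub (hf.const_mul _)) (integrable_const _),
      integral_sub (hf2.const_mul _) (hf.const_mul _), integral_const_mul, integral_const_mul,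
      integral_const, smul_eq_mul]
  have hM : 0 ≤ M := measureReal_nonneg
  rcases hM.eq_or_lt with hM0 | hM0
  · have : μ = 0 := by simpa [M, measureReal_def, ENNReal.toReal_eq_zero_iff] using hM0.symm
    simp [I, this]
  · nlinarith

section Poincare

variable {E : Type*} [NormedAddCommGroup E]

/-- The Lipschitz constant of the function grows at most linearly. -/
def LipGrowth (C : ℝ) (f : E → ℝ) : Prop :=
  ∀ x y, |f x - f y| ≤ C * (1 + ‖x‖ + ‖y‖) * ‖x - y‖

theorem LipGrowth.polyGrowth {f : E → ℝ} {C : ℝ} (hC : 0 ≤ C) (hf : LipGrowth C f) :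
    PolyGrowth f := by
  have h : PolyGrowth fun x : E => |f 0| + C * (1 + ‖x‖) * ‖x‖ := by fun_prop
  refine h.of_norm_le fun x => ?_
  have h1 := hf x 0
  rw [norm_zero, add_zero, sub_zero] at h1
  rw [Real.norm_eq_abs, Real.norm_of_nonneg (by positivity)]
  linarith [abs_sub_abs_le_abs_sub (f x) (f 0)]

theorem LipGrowth.continuous {f : E → ℝ} {C : ℝ} (hf : LipGrowth C f) : Continuous f := by
  rw [continuous_iff_continuousAt]
  intro x
  rw [ContinuousAt, tendsto_iff_norm_sub_tendsto_zero]
  have h : Tendsto (fun y => C * (1 + ‖y‖ + ‖x‖) * ‖y - x‖) (𝓝 x) (𝓝 0) := by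
    have : Continuous fun y => C * (1 + ‖y‖ + ‖x‖) * ‖y - x‖ := by fun_prop
    simpa using this.tendsto x
  exact squeeze_zero (fun y => norm_nonneg _) (fun y => hf y x) h

variable [InnerProductSpace ℝ E]

theorem LipGrowth.norm_fderiv_le {f : E → ℝ} {C : ℝ} (hC : 0 ≤ C) (hf : LipGrowth C f) (x : E) :
    ‖fderiv ℝ f x‖ ≤ C * (2 + 2 * ‖x‖) := by
  refine norm_fderiv_le_of_lip' ℝ (by positivity) ?_
  filter_upwards [Metric.ball_mem_nhds x one_pos] with y hy
  refine (hf y x).trans ?_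
  rw [mem_ball_iff_norm] at hy
  have := norm_le_norm_add_norm_sub' y x
  refine mul_le_mul_of_nonneg_right (mul_le_mul_of_nonneg_left ?_ hC) (norm_nonneg _)
  linarith

/-- The arc stays in the ball of radius `‖x‖ + ‖y‖`, where `f` is Lipschitz. This replaces
differentiability everywhere in the fundamental theorem of calculus. -/
theorem LipGrowth.absolutelyContinuous_rotation {f : E → ℝ} {C : ℝ} (hC : 0 ≤ C)
    (hf : LipGrowth C f) (x y : E) (a b : ℝ) :
    AbsolutelyContinuousOnInterval (fun θ => f (cos θ • x + sin θ • y)) a b := by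
  have hb : ∀ θ : ℝ, ‖cos θ • x + sin θ • y‖ ≤ ‖x‖ + ‖y‖ := by
    intro θ
    refine (norm_add_le _ _).trans ?_
    rw [norm_smul, norm_smul]
    exact add_le_add (mul_le_of_le_one_left (norm_nonneg _) (abs_cos_le_one θ))
      (mul_le_of_le_one_left (norm_nonneg _) (abs_sin_le_one θ))
  have hl : ∀ s t : ℝ, ‖(cos s • x + sin s • y) - (cos t • x + sin t • y)‖ ≤
      (‖x‖ + ‖y‖) * |s - t| := by
    intro s t
    have : (cos s • x + sin s • y) - (cos t • x + sin t • y) =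
        (cos s - cos t) • x + (sin s - sin t) • y := by module
    rw [this]
    refine (norm_add_le _ _).trans ?_
    rw [norm_smul, norm_smul, add_mul, mul_comm ‖x‖, mul_comm ‖y‖]
    gcongr
    · exact abs_cos_sub_cos_le s t
    · exact abs_sin_sub_sin_le s t
  set M := ‖x‖ + ‖y‖
  have hM : 0 ≤ M := by positivity
  have hlip : LipschitzWith (C * (1 + M + M) * M).toNNReal
      fun θ => f (cos θ • x + sin θ • y) := by
    refine LipschitzWith.of_dist_le_mul fun s t => ?_
    rw [Real.coe_toNNReal _ (by positivity), Real.dist_eq, Real.dist_eq, mul_assoc]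
    refine (hf _ _).trans ?_
    gcongr
    · exact hb s
    · exact hb t
    · exact hl s t
  exact hlip.lipschitzOnWith.absolutelyContinuousOnInterval

theorem LipGrowth.polyGrowth_fderiv_apply {f : E → ℝ} {C : ℝ} (hC : 0 ≤ C)
    (hf : LipGrowth C f) : PolyGrowth fun z : E × E => fderiv ℝ f z.1 z.2 := by
  have h : PolyGrowth fun z : E × E => C * (2 + 2 * ‖z.1‖) * ‖z.2‖ := by fun_prop
  refine h.of_norm_le fun z => ?_
  rw [Real.norm_of_nonneg (r := C * (2 + 2 * ‖z.1‖) * ‖z.2‖) (by positivity)]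
  refine (ContinuousLinearMap.le_opNorm _ _).trans ?_
  gcongr
  exact hf.norm_fderiv_le hC _

/-- The derivative of `f` along the rotation through `z.1` and `z.2`. -/
def rotDeriv (f : E → ℝ) (θ : ℝ) (z : E × E) : ℝ :=
  fderiv ℝ f (cos θ • z.1 + sin θ • z.2) (-sin θ • z.1 + cos θ • z.2)

theorem LipGrowth.polyGrowth_rotDeriv {f : E → ℝ} {C : ℝ} (hC : 0 ≤ C) (hf : LipGrowth C f) :
    PolyGrowth fun w : (E × E) × ℝ => rotDeriv f w.2 w.1 :=
  PolyGrowth.comp (g := fun z : E × E => fderiv ℝ f z.1 z.2)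
    (f := fun w : (E × E) × ℝ =>
      (cos w.2 • w.1.1 + sin w.2 • w.1.2, -sin w.2 • w.1.1 + cos w.2 • w.1.2))
    (hf.polyGrowth_fderiv_apply hC) (by fun_prop)

variable [FiniteDimensional ℝ E] [MeasurableSpace E] [BorelSpace E]

theorem integral_sq_strongDual_stdGaussian (L : E →L[ℝ] ℝ) :
    ∫ y, L y ^ 2 ∂stdGaussian E = ‖L‖ ^ 2 := by
  rw [← variance_dual_stdGaussian L, variance_of_integral_eq_zero L.continuous.aemeasurable
    (integral_strongDual_stdGaussian L)]

theorem measurable_fderiv_apply_prod (f : E → ℝ) :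
    Measurable fun z : E × E => fderiv ℝ f z.1 z.2 := by
  have h : Measurable fun q : (E →L[ℝ] ℝ) × E => q.1 q.2 :=
    (isBoundedBilinearMap_apply (𝕜 := ℝ) (E := E) (F := ℝ)).continuous.measurable
  exact h.comp (((measurable_fderiv ℝ f).comp measurable_fst).prodMk measurable_snd)

theorem measurable_rotDeriv (f : E → ℝ) :
    Measurable fun w : (E × E) × ℝ => rotDeriv f w.2 w.1 :=
  (measurable_fderiv_apply_prod f).comp (g := fun z : E × E => fderiv ℝ f z.1 z.2)
    (f := fun w : (E × E) × ℝ =>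
      (cos w.2 • w.1.1 + sin w.2 • w.1.2, -sin w.2 • w.1.1 + cos w.2 • w.1.2)) (by fun_prop)

/-- At each fixed angle the arc point is standard Gaussian, so `f` is differentiable there for
almost every pair. Fubini exchanges the quantifiers: for almost every pair, differentiability holds
at almost every angle. -/
theorem LipGrowth.ae_sub_eq_integral {f : E → ℝ} {C : ℝ} (hC : 0 ≤ C) (hf : LipGrowth C f)
    (hd : ∀ᵐ x ∂stdGaussian E, DifferentiableAt ℝ f x) :
    ∀ᵐ z ∂(stdGaussian E).prod (stdGaussian E),
      f z.2 - f z.1 = ∫ θ in Ioc 0 (π / 2), rotDeriv f θ z := by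
  have hm : MeasurableSet {w : ℝ × E × E |
      DifferentiableAt ℝ f (cos w.1 • w.2.1 + sin w.1 • w.2.2)} := by
    have : Measurable fun w : ℝ × E × E => cos w.1 • w.2.1 + sin w.1 • w.2.2 := by fun_prop
    exact this (measurableSet_of_differentiableAt ℝ f)
  have h1 : ∀ᵐ θ ∂(volume.restrict (Ioc 0 (π / 2))), ∀ᵐ z ∂(stdGaussian E).prod (stdGaussian E),
      DifferentiableAt ℝ f (cos θ • z.1 + sin θ • z.2) :=
    Eventually.of_forall fun θ =>
      (measurePreserving_cos_smul_add_sin_smul θ).quasiMeasurePreserving.ae hd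
  rw [Measure.ae_ae_comm hm] at h1
  filter_upwards [h1] with z hz
  have h2 := (hf.absolutelyContinuous_rotation hC z.1 z.2 0 (π / 2)).integral_deriv_eq_sub
  simp only [cos_pi_div_two, zero_smul, sin_pi_div_two, one_smul, zero_add, cos_zero, sin_zero,
    add_zero] at h2
  rw [← h2, intervalIntegral.integral_of_le (by positivity)]
  refine integral_congr_ae ?_
  filter_upwards [hz] with θ hθ
  have h1 : HasDerivAt (fun θ : ℝ => cos θ • z.1 + sin θ • z.2)
      (-sin θ • z.1 + cos θ • z.2) θ :=
    ((hasDerivAt_cos θ).smul_const z.1).add ((hasDerivAt_sin θ).smul_const z.2)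
  exact (hθ.hasFDerivAt.comp_hasDerivAt θ h1).deriv

/-- Position and velocity form a standard Gaussian pair at every angle; integrating out the velocity
turns the squared directional derivative into the squared norm. -/
theorem integral_sq_rotDeriv (f : E → ℝ) (θ : ℝ)
    (hi : Integrable (fun z : E × E => fderiv ℝ f z.1 z.2 ^ 2)
      ((stdGaussian E).prod (stdGaussian E))) :
    ∫ z, rotDeriv f θ z ^ 2 ∂(stdGaussian E).prod (stdGaussian E) =
      ∫ x, ‖fderiv ℝ f x‖ ^ 2 ∂stdGaussian E := by
  unfold rotDeriv
  rw [integral_rotation θ (f := fun z : E × E => fderiv ℝ f z.1 z.2 ^ 2) hi.aestronglyMeasurable,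
    integral_prod _ hi]
  simp only [integral_sq_strongDual_stdGaussian]

/-- A Gaussian **Poincaré inequality** (with a constant that is not optimal). -/
theorem LipGrowth.variance_le {f : E → ℝ} {C : ℝ} (hC : 0 ≤ C) (hf : LipGrowth C f)
    (hd : ∀ᵐ x ∂stdGaussian E, DifferentiableAt ℝ f x) :
    Var[f; stdGaussian E] ≤ π ^ 2 / 8 * ∫ x, ‖fderiv ℝ f x‖ ^ 2 ∂stdGaussian E := by
  have hfc := hf.continuous
  have hfg := hf.polyGrowth hC
  have hDm := measurable_rotDeriv f
  have hDg := hf.polyGrowth_rotDeriv hC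
  have hi0 : Integrable (fun z : E × E => fderiv ℝ f z.1 z.2 ^ 2)
      ((stdGaussian E).prod (stdGaussian E)) :=
    ((hf.polyGrowth_fderiv_apply hC).pow 2).integrable
      ((measurable_fderiv_apply_prod f).pow_const 2).aestronglyMeasurable
  set γ := stdGaussian E
  set ν : Measure ℝ := volume.restrict (Ioc 0 (π / 2))
  have hν : ν.real univ = π / 2 := by
    simp [ν, Real.volume_real_Ioc_of_le (show 0 ≤ π / 2 by positivity)]
  have hDi : Integrable (fun w : (E × E) × ℝ => rotDeriv f w.2 w.1) ((γ.prod γ).prod ν) :=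
    hDg.integrable hDm.aestronglyMeasurable
  have hDi2 : Integrable (fun w : (E × E) × ℝ => rotDeriv f w.2 w.1 ^ 2) ((γ.prod γ).prod ν) :=
    (hDg.pow 2).integrable (hDm.pow_const 2).aestronglyMeasurable
  have hvar : ∫ z : E × E, (f z.1 - f z.2) ^ 2 ∂γ.prod γ = 2 * Var[f; γ] := by
    have h1 : ∀ z : E × E, (f z.1 - f z.2) ^ 2 =
        f z.1 ^ 2 - 2 * (f z.1 * f z.2) + f z.2 ^ 2 := fun z => by ring
    simp_rw [h1]
    rw [integral_add (PolyGrowth.integrable_of_continuous (by fun_prop) (by fun_prop))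
      (PolyGrowth.integrable_of_continuous (by fun_prop) (by fun_prop)),
      integral_sub (PolyGrowth.integrable_of_continuous (by fun_prop) (by fun_prop))
      (PolyGrowth.integrable_of_continuous (by fun_prop) (by fun_prop)), integral_const_mul,
      integral_prod_mul, integral_fun_fst (fun x => f x ^ 2), integral_fun_snd (fun x => f x ^ 2),
      variance_eq_sub (hfg.memLp_two hfc.aestronglyMeasurable)]
    simp
    ring
  -- Cauchy–Schwarz in the angle costs `π / 2`, the later integration over the angle another `π /
  -- 2`, and `hvar` contributes `1 / 2`: hence `π² / 8`.
  have hle : ∫ z : E × E, (f z.1 - f z.2) ^ 2 ∂γ.prod γ ≤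
      ∫ z : E × E, π / 2 * ∫ θ, rotDeriv f θ z ^ 2 ∂ν ∂γ.prod γ := by
    refine integral_mono_ae (PolyGrowth.integrable_of_continuous (by fun_prop) (by fun_prop))
      (hDi2.integral_prod_left.const_mul _) ?_
    filter_upwards [hf.ae_sub_eq_integral hC hd, hDi.prod_right_ae, hDi2.prod_right_ae]
      with z hz h1 h2
    have h3 : (f z.1 - f z.2) ^ 2 = (∫ θ, rotDeriv f θ z ∂ν) ^ 2 := by
      rw [← hz]; ring
    simp only [h3, ← hν]
    exact sq_integral_le h1 h2
  rw [integral_const_mul, integral_integral_swap (f := fun z θ => rotDeriv f θ z ^ 2) hDi2] at hle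
  simp_rw [γ, integral_sq_rotDeriv f _ hi0] at hle
  rw [integral_const, hν, smul_eq_mul, hvar] at hle
  linarith

end Poincare

/-! ### Stein's equation on the real line -/

section SteinEquation

theorem integrable_exp_neg_half_sq : Integrable fun y : ℝ => rexp (-y ^ 2 / 2) := by
  refine (integrable_exp_neg_mul_sq (b := 1 / 2) (by norm_num)).congr
    (Eventually.of_forall fun y => ?_)
  simp only
  congr 1
  ring

theorem hasDerivAt_exp_neg_half_sq (y : ℝ) :
    HasDerivAt (fun y : ℝ => rexp (-y ^ 2 / 2)) (-y * rexp (-y ^ 2 / 2)) y := by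
  have h : HasDerivAt (fun y : ℝ => -y ^ 2 / 2) (-y) y := by
    refine (((hasDerivAt_pow 2 y).neg).div_const 2).congr_deriv ?_
    simp; ring
  exact h.exp.congr_deriv (by ring)

theorem integrable_mul_exp_neg_half_sq : Integrable fun y : ℝ => y * rexp (-y ^ 2 / 2) := by
  refine (integrable_mul_exp_neg_mul_sq (b := 1 / 2) (by norm_num)).congr
    (Eventually.of_forall fun y => ?_)
  simp only
  congr 2
  ring

theorem tendsto_exp_neg_half_sq_cocompact :
    Tendsto (fun y : ℝ => rexp (-y ^ 2 / 2)) (cocompact ℝ) (𝓝 0) := by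
  refine tendsto_exp_atBot.comp ?_
  have h : Tendsto (fun y : ℝ => ‖y‖ ^ 2 / 2) (cocompact ℝ) atTop :=
    ((tendsto_pow_atTop two_ne_zero).comp (tendsto_norm_cocompact_atTop (E := ℝ))).atTop_div_const
      two_pos
  refine (tendsto_neg_atTop_atBot.comp h).congr fun y => ?_
  simp [neg_div]

theorem integral_Ioi_mul_exp_neg_half_sq (x : ℝ) :
    ∫ y in Ioi x, y * rexp (-y ^ 2 / 2) = rexp (-x ^ 2 / 2) := by
  have h := integral_Ioi_of_hasDerivAt_of_tendsto' (a := x)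
    (f := fun y => -rexp (-y ^ 2 / 2)) (f' := fun y => y * rexp (-y ^ 2 / 2)) (m := 0)
    (fun y _ => (hasDerivAt_exp_neg_half_sq y).neg.congr_deriv (by ring))
    integrable_mul_exp_neg_half_sq.integrableOn
    (by simpa using (tendsto_exp_neg_half_sq_cocompact.mono_left atTop_le_cocompact).neg)
  simpa using h

theorem integral_Iic_neg_mul_exp_neg_half_sq (x : ℝ) :
    ∫ y in Iic x, -y * rexp (-y ^ 2 / 2) = rexp (-x ^ 2 / 2) := by
  have h := integral_Iic_of_hasDerivAt_of_tendsto' (a := x)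
    (f := fun y => rexp (-y ^ 2 / 2)) (f' := fun y => -y * rexp (-y ^ 2 / 2)) (m := 0)
    (fun y _ => hasDerivAt_exp_neg_half_sq y)
    (by simpa using integrable_mul_exp_neg_half_sq.neg.integrableOn)
    (tendsto_exp_neg_half_sq_cocompact.mono_left atBot_le_cocompact)
  simpa using h

theorem integral_gaussianReal_zero_one (h : ℝ → ℝ) :
    ∫ y, h y ∂gaussianReal 0 1 = (√(2 * π))⁻¹ * ∫ y, h y * rexp (-y ^ 2 / 2) := by
  rw [integral_gaussianReal_eq_integral_smul (by simp), ← integral_const_mul]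
  congr 1 with y
  simp [gaussianPDFReal]
  ring

/-- Mills-ratio argument: on a tail beyond `x` one has `|x| ≤ |y|`, and `|y|` times the Gaussian
weight has an explicit primitive. It is applied to both tails with `w` equal to that product. -/
theorem abs_setIntegral_le_of_abs_le_one {u w : ℝ → ℝ} {s : Set ℝ} (hs : MeasurableSet s) (x : ℝ)
    (hu : ∀ y, |u y| ≤ 1) (hw : IntegrableOn w s)
    (hxw : ∀ y ∈ s, |x| * rexp (-y ^ 2 / 2) ≤ w y) :
    |x * ∫ y in s, u y * rexp (-y ^ 2 / 2)| ≤ ∫ y in s, w y := by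
  rw [← integral_const_mul, ← Real.norm_eq_abs]
  refine norm_integral_le_of_norm_le hw ?_
  filter_upwards [ae_restrict_mem hs] with y hy
  refine le_trans ?_ (hxw y hy)
  rw [norm_mul, norm_mul, Real.norm_eq_abs, Real.norm_eq_abs, Real.norm_eq_abs, abs_exp]
  gcongr
  exact mul_le_of_le_one_left (exp_pos _).le (hu y)

/-- A solution of **Stein's equation** `f' - x f = h - E h(Z)` with bounded derivative. -/
theorem exists_stein_solution {h : ℝ → ℝ} (hc : Continuous h) (h0 : ∀ x, 0 ≤ h x)
    (h1 : ∀ x, h x ≤ 1) :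
    ∃ f f' : ℝ → ℝ, (∀ x, HasDerivAt f (f' x) x) ∧ Continuous f' ∧ (∀ x, |f' x| ≤ 2) ∧
      ∀ x, f' x - x * f x = h x - ∫ y, h y ∂gaussianReal 0 1 := by
  set c := ∫ y, h y ∂gaussianReal 0 1 with hcdef
  have hint : Integrable h (gaussianReal 0 1) :=
    Integrable.of_bound hc.aestronglyMeasurable 1
      (Eventually.of_forall fun x => by
        rw [Real.norm_of_nonneg (h0 x)]; exact h1 x)
  have hc0 : 0 ≤ c := integral_nonneg h0
  have hc1 : c ≤ 1 := by
    calc c ≤ ∫ _, (1 : ℝ) ∂gaussianReal 0 1 := integral_mono hint (integrable_const _) h1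
      _ = 1 := by simp
  set u : ℝ → ℝ := fun y => h y - c
  have huc : Continuous u := by fun_prop
  have hu : ∀ y, |u y| ≤ 1 := fun y => by
    rw [abs_le]; constructor <;> simp only [u] <;> linarith [h0 y, h1 y]
  set k : ℝ → ℝ := fun y => u y * rexp (-y ^ 2 / 2)
  have hkc : Continuous k := by fun_prop
  have hki : Integrable k := by
    refine integrable_exp_neg_half_sq.mono' hkc.aestronglyMeasurable
      (Eventually.of_forall fun y => ?_)
    rw [norm_mul, Real.norm_eq_abs, Real.norm_eq_abs, abs_exp]
    exact mul_le_of_le_one_left (exp_pos _).le (hu y)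
  have hk0 : ∫ y, k y = 0 := by
    have h2 := integral_gaussianReal_zero_one u
    have h3 : ∫ y, u y ∂gaussianReal 0 1 = 0 := by
      simp only [u]
      rw [integral_sub hint (integrable_const _)]
      simp [c]
    rw [h3] at h2
    have h4 : (√(2 * π))⁻¹ ≠ 0 := by positivity
    exact (mul_eq_zero.1 h2.symm).resolve_left h4
  -- The integrating factor `exp (-x² / 2)` turns Stein's equation into `Q' = k`, with solution `f =
  -- exp (x² / 2) Q`.
  set Q : ℝ → ℝ := fun x => ∫ y in Iic x, k y
  have hQ : ∀ x, HasDerivAt Q (k x) x := by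
    intro x
    have h2 : Q = fun x => Q 0 + ∫ y in (0 : ℝ)..x, k y := by
      ext z
      rw [intervalIntegral.integral_Iic_sub_Iic hki.integrableOn hki.integrableOn |>.symm]
      simp [Q]
    rw [h2]
    exact (intervalIntegral.integral_hasDerivAt_right (hkc.intervalIntegrable _ _)
      (hkc.stronglyMeasurableAtFilter _ _) hkc.continuousAt).const_add _
  -- As `k` has integral zero, `Q` can be read from either tail, so the tail not containing the
  -- origin can always be used.
  have hQ' : ∀ x, Q x = -∫ y in Ioi x, k y := by
    intro x
    have h2 := integral_add_compl (measurableSet_Iic (a := x)) hki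
    rw [hk0, compl_Iic] at h2
    simp only [Q]
    linarith
  have hbound : ∀ x, |x * Q x| ≤ rexp (-x ^ 2 / 2) := by
    intro x
    rcases le_total x 0 with hx | hx
    · rw [← integral_Iic_neg_mul_exp_neg_half_sq x]
      refine abs_setIntegral_le_of_abs_le_one measurableSet_Iic x hu ?_ fun y hy => ?_
      · simpa using integrable_mul_exp_neg_half_sq.neg.integrableOn
      · rw [abs_of_nonpos hx]
        gcongr
        exact hy
    · rw [hQ', mul_neg, abs_neg, ← integral_Ioi_mul_exp_neg_half_sq x]
      refine abs_setIntegral_le_of_abs_le_one measurableSet_Ioi x hu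
        integrable_mul_exp_neg_half_sq.integrableOn fun y hy => ?_
      rw [abs_of_nonneg hx]
      gcongr
      exact (mem_Ioi.1 hy).le
  have hexp : ∀ x : ℝ, rexp (x ^ 2 / 2) * rexp (-x ^ 2 / 2) = 1 := fun x => by
    rw [← Real.exp_add, neg_div, add_neg_cancel, Real.exp_zero]
  have hQc : Continuous Q := continuous_iff_continuousAt.2 fun x => (hQ x).continuousAt
  refine ⟨fun x => rexp (x ^ 2 / 2) * Q x, fun x => x * (rexp (x ^ 2 / 2) * Q x) + u x,
    fun x => ?_, by fun_prop, fun x => ?_, fun x => ?_⟩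
  · have h2 : HasDerivAt (fun y : ℝ => rexp (y ^ 2 / 2)) (rexp (x ^ 2 / 2) * x) x := by
      refine ((hasDerivAt_pow 2 x).div_const 2).exp.congr_deriv ?_
      simp
    refine (h2.mul (hQ x)).congr_deriv ?_
    have := hexp x
    simp only [k]
    linear_combination (u x) * this
  -- The bound 2 is `|x f x| ≤ 1` plus `|u x| ≤ 1`.
  · refine (abs_add_le _ _).trans ?_
    have h2 : |x * (rexp (x ^ 2 / 2) * Q x)| ≤ 1 := by
      rw [show x * (rexp (x ^ 2 / 2) * Q x) = rexp (x ^ 2 / 2) * (x * Q x) by ring, abs_mul,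
        abs_exp, ← hexp x]
      gcongr
      exact hbound x
    linarith [hu x]
  · simp [u]

end SteinEquation

/-! ### Total variation distance through continuous test functions -/

/-- Indicators are `L¹` limits of continuous functions, so Stein's equation is needed only for
continuous data, where its solution is continuously differentiable. -/
theorem tvDist_le_of_continuous {α β : Measure ℝ} [IsProbabilityMeasure α]
    [IsProbabilityMeasure β] {C : ℝ}
    (H : ∀ h : ℝ → ℝ, Continuous h → (∀ x, 0 ≤ h x) → (∀ x, h x ≤ 1) →
      |∫ x, h x ∂α - ∫ x, h x ∂β| ≤ C) : tvDist α β ≤ C := by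
  have : Nonempty {B : Set ℝ // MeasurableSet B} := ⟨⟨∅, MeasurableSet.empty⟩⟩
  refine ciSup_le fun ⟨B, hB⟩ => le_of_forall_pos_le_add fun ε hε => ?_
  simp only
  set f : ℝ → ℝ := B.indicator 1
  have hfi : ∀ (μ : Measure ℝ) [IsFiniteMeasure μ], Integrable f μ := fun μ _ =>
    (integrable_const (1 : ℝ)).indicator hB
  -- Approximating in `L¹ (α + β)` makes one `g` serve both measures; clamping it to `[0, 1]` only
  -- brings it closer to an indicator.
  obtain ⟨g, hg, -⟩ := (hfi (α + β)).exists_boundedContinuous_integral_sub_le hε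
  set h : ℝ → ℝ := fun x => max 0 (min 1 (g x))
  have hc : Continuous h := by fun_prop
  have h0 : ∀ x, 0 ≤ h x := fun x => le_max_left _ _
  have h1 : ∀ x, h x ≤ 1 := fun x => max_le zero_le_one (min_le_left _ _)
  have hhi : ∀ (μ : Measure ℝ) [IsFiniteMeasure μ], Integrable h μ := fun μ _ =>
    Integrable.of_bound hc.aestronglyMeasurable 1 (Eventually.of_forall fun x => by
      rw [Real.norm_of_nonneg (h0 x)]; exact h1 x)
  have hfh : ∀ x, |f x - h x| ≤ ‖f x - g x‖ := by
    intro x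
    have hf01 : f x = 0 ∨ f x = 1 := by
      by_cases hx : x ∈ B <;> simp [f, hx]
    simp only [h, Real.norm_eq_abs]
    grind
  have hsum : ∫ x, |f x - h x| ∂α + ∫ x, |f x - h x| ∂β ≤ ε := by
    rw [← integral_add_measure (by exact ((hfi α).sub (hhi α)).abs)
      (by exact ((hfi β).sub (hhi β)).abs)]
    refine le_trans (integral_mono ((hfi _).sub (hhi _)).abs ?_ hfh) hg
    exact ((hfi _).sub (g.integrable _)).norm
  have key : ∀ (μ : Measure ℝ) [IsFiniteMeasure μ], |μ.real B - ∫ x, h x ∂μ| ≤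
      ∫ x, |f x - h x| ∂μ := by
    intro μ _
    rw [← integral_indicator_one hB, ← integral_sub (hfi μ) (hhi μ)]
    exact abs_integral_le_integral_abs
  have hα := key α
  have hβ := key β
  have hH := H h hc h0 h1
  rw [abs_le] at *
  constructor <;> linarith [hα.1, hα.2, hβ.1, hβ.2, hH.1, hH.2]

/-! ### Normal approximation for functions with a Lipschitz gradient -/

section NormalApproximation

theorem sq_norm_integral_le {α E : Type*} [NormedAddCommGroup E] [NormedSpace ℝ E]
    [MeasurableSpace α] {μ : Measure α} [IsProbabilityMeasure μ] {f : α → E} (hf : Integrable f μ)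
    (hf2 : Integrable (fun x => ‖f x‖ ^ 2) μ) :
    ‖∫ x, f x ∂μ‖ ^ 2 ≤ ∫ x, ‖f x‖ ^ 2 ∂μ := by
  have h1 := sq_integral_le hf.norm hf2
  rw [probReal_univ, one_mul] at h1
  refine le_trans ?_ h1
  gcongr
  exact norm_integral_le_integral_norm f

variable {E : Type*} [NormedAddCommGroup E] [InnerProductSpace ℝ E] [FiniteDimensional ℝ E]
  [MeasurableSpace E] {p : E → E}

theorem rotAverage_const_smul (c : ℝ) (x : E) :
    rotAverage (fun y => c • p y) x = c • rotAverage p x :=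
  integral_smul c _

variable [BorelSpace E]

theorem integrable_rotAverage (hp : LipschitzWith 1 p) (x : E) :
    Integrable (fun q : ℝ × E => p (cos q.1 • x + sin q.1 • q.2))
      (angleMeasure.prod (stdGaussian E)) := by
  have hpc := hp.continuous
  have hpg := PolyGrowth.of_lipschitzWith hp
  exact PolyGrowth.integrable_of_continuous (by fun_prop) (by fun_prop)

/-- The rotation scales the base point by `cos θ`, whose mean under `angleMeasure` is `1 / 2`. -/
theorem lipschitzWith_rotAverage (hp : LipschitzWith 1 p) :
    LipschitzWith (1 / 2) (rotAverage p) := by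
  refine LipschitzWith.of_dist_le_mul fun x y => ?_
  rw [dist_eq_norm, dist_eq_norm, rotAverage, rotAverage,
    ← integral_sub (integrable_rotAverage hp x) (integrable_rotAverage hp y)]
  have hi : Integrable (fun q : ℝ × E => cos q.1 * ‖x - y‖)
      (angleMeasure.prod (stdGaussian E)) :=
    PolyGrowth.integrable_of_continuous (by fun_prop) (by fun_prop)
  have hae : ∀ᵐ θ ∂angleMeasure, 0 ≤ cos θ := by
    have h1 : ∀ᵐ θ ∂volume.restrict (Ioc 0 (π / 2)), 0 ≤ cos θ := by
      filter_upwards [ae_restrict_mem measurableSet_Ioc] with θ hθ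
      exact cos_nonneg_of_neg_pi_div_two_le_of_le (by linarith [hθ.1, pi_pos]) hθ.2
    exact angleMeasure_le.absolutelyContinuous.ae_le h1
  have h2 : ∀ᵐ q ∂angleMeasure.prod (stdGaussian E), 0 ≤ cos q.1 :=
    Measure.quasiMeasurePreserving_fst.ae hae
  refine (norm_integral_le_of_norm_le hi ?_).trans ?_
  · filter_upwards [h2] with q hq
    have h3 := hp.norm_sub_le (cos q.1 • x + sin q.1 • q.2) (cos q.1 • y + sin q.1 • q.2)
    rwa [add_sub_add_right_eq_sub, ← smul_sub, norm_smul, Real.norm_of_nonneg hq,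
      NNReal.coe_one, one_mul] at h3
  · rw [integral_mul_const, integral_fun_fst cos, integral_cos_angleMeasure]
    simp

/-- Jensen's inequality, then rotation invariance: each rotated point is again standard Gaussian. -/
theorem integral_sq_norm_rotAverage_le (hp : LipschitzWith 1 p) :
    ∫ x, ‖rotAverage p x‖ ^ 2 ∂stdGaussian E ≤ ∫ x, ‖p x‖ ^ 2 ∂stdGaussian E := by
  have hpc := hp.continuous
  have hpg := PolyGrowth.of_lipschitzWith hp
  have hHc := (lipschitzWith_rotAverage hp).continuous
  have hHg := PolyGrowth.of_lipschitzWith (lipschitzWith_rotAverage hp)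
  set γ := stdGaussian E
  have hi : Integrable (fun w : E × ℝ × E => ‖p (cos w.2.1 • w.1 + sin w.2.1 • w.2.2)‖ ^ 2)
      (γ.prod (angleMeasure.prod γ)) :=
    PolyGrowth.integrable_of_continuous (by fun_prop) (by fun_prop)
  calc ∫ x, ‖rotAverage p x‖ ^ 2 ∂γ
      ≤ ∫ x, ∫ q : ℝ × E, ‖p (cos q.1 • x + sin q.1 • q.2)‖ ^ 2 ∂angleMeasure.prod γ ∂γ := by
        refine integral_mono (PolyGrowth.integrable_of_continuous (by fun_prop) (by fun_prop))
          hi.integral_prod_left fun x => ?_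
        exact sq_norm_integral_le (integrable_rotAverage hp x)
          (PolyGrowth.integrable_of_continuous (by fun_prop) (by fun_prop))
    _ = ∫ w : ℝ × E × E, ‖p (cos w.1 • w.2.1 + sin w.1 • w.2.2)‖ ^ 2
          ∂angleMeasure.prod (γ.prod γ) := by
        rw [← (measurePreserving_prod_left_comm γ angleMeasure γ).map_eq,
          integral_map (by fun_prop) (Continuous.aestronglyMeasurable (by fun_prop)),
          integral_prod _ hi]
    _ = ∫ θ, ∫ z : E × E, ‖p (cos θ • z.1 + sin θ • z.2)‖ ^ 2 ∂γ.prod γ ∂angleMeasure :=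
        integral_prod _ (PolyGrowth.integrable_of_continuous (by fun_prop) (by fun_prop))
    _ = ∫ θ, ∫ x, ‖p x‖ ^ 2 ∂γ ∂angleMeasure := by
        congr 1 with θ
        have h := integral_rotation (E := E) θ (f := fun z => ‖p z.1‖ ^ 2)
          (Continuous.aestronglyMeasurable (by fun_prop))
        rw [h, integral_fun_fst (fun x => ‖p x‖ ^ 2)]
        simp [γ]
    _ = ∫ x, ‖p x‖ ^ 2 ∂γ := by simp

theorem lipGrowth_inner_rotAverage (hp : LipschitzWith 1 p) :
    LipGrowth (4 * (1 + ‖rotAverage p 0‖ + ‖p 0‖)) fun x => 4 * ⟪p x, rotAverage p x⟫ := by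
  intro x y
  set H := rotAverage p
  have hH := lipschitzWith_rotAverage hp
  have h1 : ⟪p x, H x⟫ - ⟪p y, H y⟫ = ⟪p x - p y, H x⟫ + ⟪p y, H x - H y⟫ := by
    simp only [inner_sub_left, inner_sub_right]; ring
  have h2 := abs_real_inner_le_norm (p x - p y) (H x)
  have h3 := abs_real_inner_le_norm (p y) (H x - H y)
  have h4 := hp.norm_sub_le x y
  have h5 := hH.norm_sub_le x y
  have h6 := hH.norm_sub_le x 0
  have h7 := hp.norm_sub_le y 0
  have h8 := norm_le_norm_add_norm_sub' (H x) (H 0)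
  have h9 := norm_le_norm_add_norm_sub' (p y) (p 0)
  simp only [NNReal.coe_one, one_mul, sub_zero, NNReal.coe_div, NNReal.coe_ofNat] at h4 h5 h6 h7
  have hH2 : ‖H x‖ ≤ ‖H 0‖ + 1 / 2 * ‖x‖ := by linarith
  have hp2 : ‖p y‖ ≤ ‖p 0‖ + ‖y‖ := by linarith
  rw [← mul_sub, abs_mul, abs_of_pos (four_pos : (0 : ℝ) < 4), mul_assoc, mul_assoc]
  refine mul_le_mul_of_nonneg_left ?_ zero_le_four
  calc |⟪p x, H x⟫ - ⟪p y, H y⟫| ≤ ‖p x - p y‖ * ‖H x‖ + ‖p y‖ * ‖H x - H y‖ := by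
        rw [h1]; exact (abs_add_le _ _).trans (add_le_add h2 h3)
    _ ≤ ‖x - y‖ * (‖H 0‖ + 1 / 2 * ‖x‖) + (‖p 0‖ + ‖y‖) * (1 / 2 * ‖x - y‖) := by gcongr
    _ = (‖H 0‖ + 1 / 2 * ‖x‖ + 1 / 2 * ‖p 0‖ + 1 / 2 * ‖y‖) * ‖x - y‖ := by ring
    _ ≤ ((1 + ‖H 0‖ + ‖p 0‖) * (1 + ‖x‖ + ‖y‖)) * ‖x - y‖ := by
        gcongr
        have a1 := norm_nonneg (H 0)
        have a2 := norm_nonneg (p 0)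
        have a3 := norm_nonneg x
        have a4 := norm_nonneg y
        nlinarith [mul_nonneg a1 a3, mul_nonneg a1 a4, mul_nonneg a2 a3, mul_nonneg a2 a4]
    _ = _ := by ring

/-- Rademacher's theorem and the product rule, with Lipschitz constants 1 and `1 / 2` for the two
factors. -/
theorem ae_norm_fderiv_inner_rotAverage_le (hp : LipschitzWith 1 p) :
    ∀ᵐ x ∂stdGaussian E, DifferentiableAt ℝ (fun x => 4 * ⟪p x, rotAverage p x⟫) x ∧
      ‖fderiv ℝ (fun x => 4 * ⟪p x, rotAverage p x⟫) x‖ ≤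
        4 * (‖rotAverage p x‖ + 1 / 2 * ‖p x‖) := by
  have hH := lipschitzWith_rotAverage hp
  filter_upwards [stdGaussian_absolutelyContinuous.ae_le
    (hp.ae_differentiableAt (μ := (volume : Measure E))),
    stdGaussian_absolutelyContinuous.ae_le
    (hH.ae_differentiableAt (μ := (volume : Measure E)))] with x h1 h2
  have hd := (h1.hasFDerivAt.inner ℝ h2.hasFDerivAt).const_mul (4 : ℝ)
  refine ⟨hd.differentiableAt, ?_⟩
  rw [hd.fderiv]
  refine ContinuousLinearMap.opNorm_le_bound _ (by positivity) fun v => ?_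
  have a1 : ‖fderiv ℝ p x v‖ ≤ ‖v‖ := by
    refine (ContinuousLinearMap.le_opNorm _ _).trans ?_
    have := norm_fderiv_le_of_lipschitz ℝ hp (x₀ := x)
    exact mul_le_of_le_one_left (norm_nonneg v) (by simpa using this)
  have a2 : ‖fderiv ℝ (rotAverage p) x v‖ ≤ 1 / 2 * ‖v‖ := by
    refine (ContinuousLinearMap.le_opNorm _ _).trans ?_
    have := norm_fderiv_le_of_lipschitz ℝ hH (x₀ := x)
    gcongr
    simpa using this
  have a3 : |⟪p x, fderiv ℝ (rotAverage p) x v⟫| ≤ ‖p x‖ * (1 / 2 * ‖v‖) :=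
    (abs_real_inner_le_norm _ _).trans (by gcongr)
  have a4 : |⟪fderiv ℝ p x v, rotAverage p x⟫| ≤ ‖v‖ * ‖rotAverage p x‖ :=
    (abs_real_inner_le_norm _ _).trans (by gcongr)
  simp only [smul_apply, ContinuousLinearMap.comp_apply,
    ContinuousLinearMap.prod_apply, fderivInnerCLM_apply, smul_eq_mul, norm_mul,
    Real.norm_ofNat]
  have a5 := (abs_add_le ⟪p x, fderiv ℝ (rotAverage p) x v⟫
    ⟪fderiv ℝ p x v, rotAverage p x⟫).trans (add_le_add a3 a4)
  rw [mul_assoc]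
  refine mul_le_mul_of_nonneg_left ?_ zero_le_four
  rw [Real.norm_eq_abs]
  linarith

theorem variance_inner_rotAverage_le (hp : LipschitzWith 1 p) :
    Var[fun x => 4 * ⟪p x, rotAverage p x⟫; stdGaussian E] ≤
      64 * ∫ x, ‖p x‖ ^ 2 ∂stdGaussian E := by
  have hpc := hp.continuous
  have hpg := PolyGrowth.of_lipschitzWith hp
  have hHc := (lipschitzWith_rotAverage hp).continuous
  have hHg := PolyGrowth.of_lipschitzWith (lipschitzWith_rotAverage hp)
  have hae := ae_norm_fderiv_inner_rotAverage_le hp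
  have h1 := (lipGrowth_inner_rotAverage hp).variance_le (by positivity)
    (hae.mono fun x hx => hx.1)
  set V := ∫ x, ‖p x‖ ^ 2 ∂stdGaussian E
  have hV : 0 ≤ V := integral_nonneg fun x => by positivity
  have hip : Integrable (fun x => ‖p x‖ ^ 2) (stdGaussian E) :=
    PolyGrowth.integrable_of_continuous (by fun_prop) (by fun_prop)
  have hiH : Integrable (fun x => ‖rotAverage p x‖ ^ 2) (stdGaussian E) :=
    PolyGrowth.integrable_of_continuous (by fun_prop) (by fun_prop)
  have h2 : ∫ x, ‖fderiv ℝ (fun x => 4 * ⟪p x, rotAverage p x⟫) x‖ ^ 2 ∂stdGaussian E ≤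
      36 * V := by
    calc _ ≤ ∫ x, (24 * ‖rotAverage p x‖ ^ 2 + 12 * ‖p x‖ ^ 2) ∂stdGaussian E := by
          refine integral_mono_of_nonneg (Eventually.of_forall fun x => by positivity)
            ((hiH.const_mul _).add (hip.const_mul _)) ?_
          filter_upwards [hae] with x hx
          calc _ ≤ (4 * (‖rotAverage p x‖ + 1 / 2 * ‖p x‖)) ^ 2 := by
                gcongr
                exact hx.2
            -- The cross term `16 ‖rotAverage p x‖ ‖p x‖` is split evenly by AM–GM.
            _ ≤ _ := by nlinarith [sq_nonneg (‖rotAverage p x‖ - ‖p x‖)]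
      _ = 24 * ∫ x, ‖rotAverage p x‖ ^ 2 ∂stdGaussian E + 12 * V := by
          rw [integral_add (hiH.const_mul _) (hip.const_mul _), integral_const_mul,
            integral_const_mul]
      _ ≤ 36 * V := by linarith [integral_sq_norm_rotAverage_le hp]
  have hπ : π ^ 2 ≤ 10 := by
    have := pi_lt_d2
    nlinarith [pi_pos]
  refine h1.trans ?_
  -- The Poincaré constant leaves `45 V`; rounding up to `64 V` gives the square root 8 used later.
  calc _ ≤ 10 / 8 * (36 * V) := by gcongr
    _ ≤ 64 * V := by linarith

/-- The second-order bound for the distance of `F` from its Gaussian approximation, for a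
continuous test function. -/
theorem abs_integral_sub_integral_gaussianReal_le (hp : LipschitzWith 1 p) {F : E → ℝ}
    (hF : ∀ x, HasGradientAt F ((2 : ℝ) • p x) x) (hFg : PolyGrowth F) {σ : ℝ} (hσ : 0 < σ)
    (hσ2 : σ ^ 2 = Var[F; stdGaussian E]) {h : ℝ → ℝ} (hc : Continuous h) (h0 : ∀ x, 0 ≤ h x)
    (h1 : ∀ x, h x ≤ 1) :
    |∫ x, h ((F x - ∫ y, F y ∂stdGaussian E) / σ) ∂stdGaussian E - ∫ y, h y ∂gaussianReal 0 1| ≤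
      16 * √(∫ x, ‖p x‖ ^ 2 ∂stdGaussian E) / σ ^ 2 := by
  obtain ⟨f, f', hf, hf'c, hf'2, hfe⟩ := exists_stein_solution hc h0 h1
  have hfc : Continuous f := continuous_iff_continuousAt.2 fun x => (hf x).continuousAt
  have hfg : PolyGrowth f := by
    have : LipschitzWith 2 f := by
      refine lipschitzWith_of_nnnorm_deriv_le (fun x => (hf x).differentiableAt) fun x => ?_
      rw [(hf x).deriv, ← NNReal.coe_le_coe]
      simpa using hf'2 x
    exact PolyGrowth.of_lipschitzWith this
  have hf'g : PolyGrowth f' :=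
    (PolyGrowth.const (2 : ℝ)).of_norm_le fun x => by simpa using hf'2 x
  have hFc : Continuous F := continuous_iff_continuousAt.2 fun x => (hF x).continuousAt
  have hpc := hp.continuous
  have hpg := PolyGrowth.of_lipschitzWith hp
  have hHc := (lipschitzWith_rotAverage hp).continuous
  have hHg := PolyGrowth.of_lipschitzWith (lipschitzWith_rotAverage hp)
  set γ := stdGaussian E
  set m := ∫ y, F y ∂γ
  set G : E → ℝ := fun x => 4 * ⟪p x, rotAverage p x⟫
  have hGc : Continuous G := by fun_prop
  have hGg : PolyGrowth G := by fun_prop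
  set W : E → ℝ := fun x => (F x - m) / σ
  have hWc : Continuous W := by fun_prop
  have hWg : PolyGrowth W := by
    simp only [W, div_eq_mul_inv]; fun_prop
  have hG : ∀ x, ⟪(2 : ℝ) • p x, rotAverage (fun y => (2 : ℝ) • p y) x⟫ = G x := by
    intro x
    rw [rotAverage_const_smul, inner_smul_left, inner_smul_right]
    simp only [G, RCLike.conj_to_real]
    ring
  -- The covariance identity with `g = F`.
  have hGint : ∫ x, G x ∂γ = σ ^ 2 := by
    have := covariance_eq_integral_inner_rotAverage hF hFg (by fun_prop) (by fun_prop) hF hFg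
      (by fun_prop) (by fun_prop)
    simp only [hG] at this
    rw [← this, hσ2, variance_eq_sub (hFg.memLp_two hFc.aestronglyMeasurable)]
    simp [sq, γ]
  have hg : ∀ x, HasGradientAt (fun x => f (W x)) ((f' (W x) / σ) • (2 : ℝ) • p x) x := by
    intro x
    rw [hasGradientAt_iff_hasFDerivAt]
    have hW : HasFDerivAt W (σ⁻¹ • InnerProductSpace.toDual ℝ E ((2 : ℝ) • p x)) x := by
      have := ((hF x).hasFDerivAt.sub_const m).const_mul σ⁻¹
      refine this.congr_of_eventuallyEq (Eventually.of_forall fun y => ?_)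
      simp only [W, div_eq_inv_mul]
    refine ((hf (W x)).comp_hasFDerivAt x hW).congr_fderiv ?_
    ext v
    simp [div_eq_mul_inv, mul_assoc]
  have hcov := covariance_eq_integral_inner_rotAverage hF hFg (by fun_prop) (by fun_prop) hg
    (by fun_prop) (by fun_prop) (by simp only [div_eq_mul_inv]; fun_prop)
  simp only [inner_smul_left _ _ (f' _ / σ), hG, RCLike.conj_to_real] at hcov
  have hifW : Integrable (fun x => f (W x)) γ :=
    PolyGrowth.integrable_of_continuous (by fun_prop) (by fun_prop)
  have hifWF : Integrable (fun x => f (W x) * F x) γ :=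
    PolyGrowth.integrable_of_continuous (by fun_prop) (by fun_prop)
  have hif'G : Integrable (fun x => f' (W x) * G x) γ :=
    PolyGrowth.integrable_of_continuous (by fun_prop) (by fun_prop)
  have hif' : Integrable (fun x => f' (W x)) γ :=
    PolyGrowth.integrable_of_continuous (by fun_prop) (by fun_prop)
  have hifWW : Integrable (fun x => W x * f (W x)) γ :=
    PolyGrowth.integrable_of_continuous (by fun_prop) (by fun_prop)
  have hiG : Integrable G γ := hGg.integrable_of_continuous hGc
  -- The Stein kernel property of `G`: one factor `σ` comes from `W`, the other from the chain rule.
  have hWf : ∫ x, W x * f (W x) ∂γ = (∫ x, f' (W x) * G x ∂γ) / σ ^ 2 := by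
    have e1 : ∫ x, W x * f (W x) ∂γ =
        (∫ x, f (W x) * F x ∂γ - (∫ x, f (W x) ∂γ) * m) / σ := by
      rw [← integral_mul_const, ← integral_sub hifWF (hifW.mul_const m), ← integral_div]
      congr 1 with x
      simp only [W]
      ring
    rw [e1, hcov, ← integral_div, ← integral_div]
    congr 1 with x
    field_simp
  have hmain : ∫ x, h (W x) ∂γ - ∫ y, h y ∂gaussianReal 0 1 =
      ∫ x, f' (W x) * ((σ ^ 2 - G x) / σ ^ 2) ∂γ := by
    have e1 : ∀ x, h (W x) = f' (W x) - W x * f (W x) + ∫ y, h y ∂gaussianReal 0 1 := fun x => by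
      linarith [hfe (W x)]
    simp_rw [e1]
    rw [integral_add (by exact hif'.sub hifWW) (integrable_const _), integral_sub hif' hifWW, hWf,
      integral_const, ← integral_div, ← integral_sub hif' (hif'G.div_const _)]
    simp only [γ, probReal_univ, one_smul, add_sub_cancel_right]
    congr 1 with x
    field_simp
  have hvar : (∫ x, |G x - σ ^ 2| ∂γ) ^ 2 ≤ 64 * ∫ x, ‖p x‖ ^ 2 ∂γ := by
    have hi : Integrable (fun x => |G x - σ ^ 2|) γ := (hiG.sub (integrable_const _)).abs
    have hi2 : Integrable (fun x => |G x - σ ^ 2| ^ 2) γ := by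
      simp only [sq_abs]
      exact PolyGrowth.integrable_of_continuous (by fun_prop) (by fun_prop)
    have e1 := sq_integral_le hi hi2
    rw [probReal_univ, one_mul] at e1
    refine e1.trans (le_trans (le_of_eq ?_) (variance_inner_rotAverage_le hp))
    rw [variance_eq_integral hGc.aemeasurable]
    change _ = ∫ x, (G x - ∫ x, G x ∂γ) ^ 2 ∂γ
    simp only [hGint, sq_abs]
  have hV : 0 ≤ ∫ x, ‖p x‖ ^ 2 ∂γ := integral_nonneg fun x => by positivity
  have hsqrt : ∫ x, |G x - σ ^ 2| ∂γ ≤ 8 * √(∫ x, ‖p x‖ ^ 2 ∂γ) := by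
    refine abs_le_of_sq_le_sq' ?_ (by positivity) |>.2
    rw [mul_pow, sq_sqrt hV]
    linarith
  rw [hmain, ← Real.norm_eq_abs]
  calc _ ≤ ∫ x, 2 * (|G x - σ ^ 2| / σ ^ 2) ∂γ := by
        refine norm_integral_le_of_norm_le
          (((hiG.sub (integrable_const _)).abs.div_const _).const_mul _)
          (Eventually.of_forall fun x => ?_)
        rw [norm_mul, norm_div, Real.norm_eq_abs, Real.norm_eq_abs, abs_sub_comm,
          Real.norm_of_nonneg (sq_nonneg σ)]
        gcongr
        exact hf'2 _
    _ = 2 * ((∫ x, |G x - σ ^ 2| ∂γ) / σ ^ 2) := by rw [integral_const_mul, integral_div]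
    _ ≤ 2 * ((8 * √(∫ x, ‖p x‖ ^ 2 ∂γ)) / σ ^ 2) := by gcongr
    _ = _ := by ring

end NormalApproximation

/-! ### Integration by parts for Lipschitz functions -/

section Lipschitz

variable {E : Type*} [NormedAddCommGroup E] [InnerProductSpace ℝ E]

/-- The average of `f` over the segment from `x` to `x + t • v`. -/
def segmentAverage (f : E → ℝ) (v : E) (t : ℝ) (x : E) : ℝ :=
  t⁻¹ * ∫ u in (0 : ℝ)..t, f (x + u • v)

/-- Moving `x` along `v` shifts the endpoints of the integration window, so the derivative is the
difference quotient of `f`. -/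
theorem hasLineDerivAt_segmentAverage {f : E → ℝ} (hf : Continuous f) (v : E) (t : ℝ) (x : E) :
    HasLineDerivAt ℝ (segmentAverage f v t) (t⁻¹ * (f (x + t • v) - f x)) x v := by
  have hc : Continuous fun u : ℝ => f (x + u • v) := by fun_prop
  have h1 : (fun r : ℝ => segmentAverage f v t (x + r • v)) = fun r => t⁻¹ *
      ((∫ u in (0 : ℝ)..(r + t), f (x + u • v)) - ∫ u in (0 : ℝ)..r, f (x + u • v)) := by
    ext r
    rw [segmentAverage, intervalIntegral.integral_interval_sub_left
      (hc.intervalIntegrable _ _) (hc.intervalIntegrable _ _)]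
    have h2 := intervalIntegral.integral_comp_add_right (a := 0) (b := t)
      (fun u : ℝ => f (x + u • v)) r
    rw [zero_add, add_comm t r] at h2
    rw [← h2]
    congr 2 with u
    congr 1
    module
  rw [HasLineDerivAt, h1]
  have hd : ∀ r : ℝ, HasDerivAt (fun r => ∫ u in (0 : ℝ)..r, f (x + u • v)) (f (x + r • v)) r :=
    fun r => intervalIntegral.integral_hasDerivAt_right (hc.intervalIntegrable _ _)
      (hc.stronglyMeasurableAtFilter _ _) hc.continuousAt
  have h3 : HasDerivAt (fun r => ∫ u in (0 : ℝ)..(r + t), f (x + u • v)) (f (x + t • v)) 0 := by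
    have := HasDerivAt.comp_add_const 0 t (by rw [zero_add]; exact hd t)
    exact this
  have h4 := (h3.sub (hd 0)).const_mul t⁻¹
  simpa using h4

theorem abs_segmentAverage_sub_le {f : E → ℝ} {C : ℝ≥0} (hf : LipschitzWith C f) (v : E) {t : ℝ}
    (ht : 0 < t) (x : E) : |segmentAverage f v t x - f x| ≤ C * ‖v‖ * t := by
  have hc : Continuous fun u : ℝ => f (x + u • v) := by have := hf.continuous; fun_prop
  have h1 : segmentAverage f v t x - f x = t⁻¹ * ∫ u in (0 : ℝ)..t, (f (x + u • v) - f x) := by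
    rw [intervalIntegral.integral_sub (hc.intervalIntegrable _ _) (by simp), segmentAverage,
      mul_sub, intervalIntegral.integral_const]
    simp [ht.ne']
  have h2 : ‖∫ u in (0 : ℝ)..t, (f (x + u • v) - f x)‖ ≤ (C * ‖v‖ * t) * |t - 0| := by
    refine intervalIntegral.norm_integral_le_of_norm_le_const fun u hu => ?_
    rw [uIoc_of_le ht.le] at hu
    refine (hf.norm_sub_le _ _).trans ?_
    rw [add_sub_cancel_left, norm_smul, Real.norm_of_nonneg hu.1.le, mul_assoc,
      mul_comm ‖v‖ t]
    gcongr
    exact hu.2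
  rw [sub_zero, abs_of_pos ht] at h2
  rw [h1, abs_mul, abs_of_pos (inv_pos.2 ht), ← Real.norm_eq_abs]
  calc _ ≤ t⁻¹ * ((C * ‖v‖ * t) * t) := by gcongr
    _ = _ := by field_simp

theorem lipschitzWith_segmentAverage {f : E → ℝ} {C : ℝ≥0} (hf : LipschitzWith C f) (v : E)
    {t : ℝ} (ht : 0 < t) : LipschitzWith C (segmentAverage f v t) := by
  refine LipschitzWith.of_dist_le_mul fun x y => ?_
  have hc : ∀ x, Continuous fun u : ℝ => f (x + u • v) := by
    have := hf.continuous; intro x; fun_prop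
  rw [Real.dist_eq, segmentAverage, segmentAverage, ← mul_sub, abs_mul,
    abs_of_pos (inv_pos.2 ht), ← intervalIntegral.integral_sub ((hc x).intervalIntegrable _ _)
    ((hc y).intervalIntegrable _ _)]
  have h2 : ‖∫ u in (0 : ℝ)..t, (f (x + u • v) - f (y + u • v))‖ ≤
      (C * dist x y) * |t - 0| := by
    refine intervalIntegral.norm_integral_le_of_norm_le_const fun u _ => ?_
    refine (hf.norm_sub_le _ _).trans ?_
    rw [add_sub_add_right_eq_sub, dist_eq_norm]
  rw [sub_zero, abs_of_pos ht] at h2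
  rw [← Real.norm_eq_abs]
  calc _ ≤ t⁻¹ * ((C * dist x y) * t) := by gcongr
    _ = _ := by field_simp

variable [FiniteDimensional ℝ E] [MeasurableSpace E] [BorelSpace E]

/-- Stein's lemma without differentiability everywhere. It holds for `segmentAverage f v t`, whose
derivative is a difference quotient. As `t → 0` the quotients converge under the integral because
`f` is Lipschitz, while the averages are uniformly within `O(t)` of `f`. -/
theorem integral_lineDeriv_stdGaussian {f : E → ℝ} {C : ℝ≥0} (hf : LipschitzWith C f) (v : E) :
    ∫ x, lineDeriv ℝ f x v ∂stdGaussian E = ∫ x, f x * ⟪x, v⟫ ∂stdGaussian E := by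
  have hfc := hf.continuous
  have hfg := PolyGrowth.of_lipschitzWith hf
  have h1 := hf.integral_inv_smul_sub_mul_tendsto_integral_lineDeriv_mul (v := v)
    (integrable_gaussDensity (E := E))
  simp only [smul_eq_mul, ← integral_stdGaussian] at h1
  refine tendsto_nhds_unique h1 ?_
  have hibp : ∀ t : ℝ, 0 < t → ∫ x, t⁻¹ * (f (x + t • v) - f x) ∂stdGaussian E =
      ∫ x, segmentAverage f v t x * ⟪x, v⟫ ∂stdGaussian E := by
    intro t ht
    have hs := lipschitzWith_segmentAverage hf v ht
    have hsc := hs.continuous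
    have hsg := PolyGrowth.of_lipschitzWith hs
    exact (integral_mul_inner_stdGaussian (hasLineDerivAt_segmentAverage hfc v t)
      (PolyGrowth.integrable_of_continuous (by fun_prop) (by fun_prop))
      (PolyGrowth.integrable_of_continuous (by fun_prop) (by fun_prop))
      (PolyGrowth.integrable_of_continuous (by fun_prop) (by fun_prop))).symm
  rw [tendsto_iff_norm_sub_tendsto_zero]
  have hlim : Tendsto (fun t : ℝ => t * (C * ‖v‖ * ∫ x : E, |⟪x, v⟫| ∂stdGaussian E))
      (𝓝[>] 0) (𝓝 0) := by
    have : Continuous fun t : ℝ => t * (C * ‖v‖ * ∫ x : E, |⟪x, v⟫| ∂stdGaussian E) := by fun_prop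
    simpa using (this.tendsto 0).mono_left nhdsWithin_le_nhds
  refine squeeze_zero' (Eventually.of_forall fun t => norm_nonneg _) ?_ hlim
  filter_upwards [self_mem_nhdsWithin] with t ht
  have ht : 0 < t := ht
  have hs := lipschitzWith_segmentAverage hf v ht
  have hsc := hs.continuous
  have hsg := PolyGrowth.of_lipschitzWith hs
  rw [hibp t ht, ← integral_sub (PolyGrowth.integrable_of_continuous (by fun_prop) (by fun_prop))
    (PolyGrowth.integrable_of_continuous (by fun_prop) (by fun_prop)), ← mul_assoc,
    ← integral_const_mul]
  have hi : Integrable (fun x : E => |⟪x, v⟫|) (stdGaussian E) :=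
    (PolyGrowth.integrable_of_continuous (f := fun x : E => ⟪x, v⟫)
      (by fun_prop) (by fun_prop)).abs
  refine norm_integral_le_of_norm_le (hi.const_mul _) (Eventually.of_forall fun x => ?_)
  rw [← sub_mul, norm_mul, Real.norm_eq_abs, Real.norm_eq_abs]
  have := abs_segmentAverage_sub_le hf v ht x
  gcongr
  linarith

end Lipschitz

/-! ### A lower bound for the variance -/

section Variance

variable {E : Type*} [NormedAddCommGroup E] [InnerProductSpace ℝ E] [FiniteDimensional ℝ E]
  [MeasurableSpace E] [BorelSpace E]

/-- Stein's lemma in each basis direction applied to `f x * ⟪B x, e i⟫`; differentiating the second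
factor yields the trace of `B`. -/
theorem integral_mul_inner_apply_self_stdGaussian {f : E → ℝ} {f' : E → E}
    (hf : ∀ x, HasGradientAt f (f' x) x) (hfg : PolyGrowth f) (hf'c : Continuous f')
    (hf'g : PolyGrowth f') (B : E →L[ℝ] E) :
    ∫ x, f x * ⟪B x, x⟫ ∂stdGaussian E = ∫ x, ⟪f' x, B x⟫ ∂stdGaussian E +
      (∑ i, ⟪B (stdOrthonormalBasis ℝ E i), stdOrthonormalBasis ℝ E i⟫) *
        ∫ x, f x ∂stdGaussian E := by
  set e := stdOrthonormalBasis ℝ E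
  have hfc : Continuous f := continuous_iff_continuousAt.2 fun x => (hf x).continuousAt
  have hBg : PolyGrowth B := PolyGrowth.of_lipschitzWith B.lipschitz
  have hi : ∀ i, ∫ x, (f x * ⟪B x, e i⟫) * ⟪x, e i⟫ ∂stdGaussian E =
      ∫ x, ⟪f' x, e i⟫ * ⟪e i, B x⟫ ∂stdGaussian E +
        ⟪B (e i), e i⟫ * ∫ x, f x ∂stdGaussian E := by
    intro i
    have hd : ∀ x, HasLineDerivAt ℝ (fun x => f x * ⟪B x, e i⟫)
        (⟪f' x, e i⟫ * ⟪e i, B x⟫ + ⟪B (e i), e i⟫ * f x) x (e i) := by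
      intro x
      have h1 := (hf x).hasFDerivAt.mul
        (B.hasFDerivAt.inner ℝ (hasFDerivAt_const (e i) x))
      have h2 := h1.hasLineDerivAt (e i)
      have h3 : ⟪f' x, e i⟫ * ⟪e i, B x⟫ + ⟪B (e i), e i⟫ * f x = (f x •
          (fderivInnerCLM ℝ (B x, e i)).comp (B.prod 0) +
          ⟪B x, e i⟫ • InnerProductSpace.toDual ℝ E (f' x)) (e i) := by
        simp [real_inner_comm]
        ring
      rw [h3]
      exact h2
    rw [integral_mul_inner_stdGaussian hd
      (PolyGrowth.integrable_of_continuous (by fun_prop) (by fun_prop))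
      (PolyGrowth.integrable_of_continuous (by fun_prop) (by fun_prop))
      (PolyGrowth.integrable_of_continuous (by fun_prop) (by fun_prop)),
      integral_add (PolyGrowth.integrable_of_continuous (by fun_prop) (by fun_prop))
      (PolyGrowth.integrable_of_continuous (by fun_prop) (by fun_prop)), integral_const_mul]
  have h1 : ∀ x, f x * ⟪B x, x⟫ = ∑ i, (f x * ⟪B x, e i⟫) * ⟪x, e i⟫ := by
    intro x
    rw [← e.sum_inner_mul_inner (B x) x, Finset.mul_sum]
    simp only [mul_assoc, real_inner_comm x]
  have h2 : ∀ x, ⟪f' x, B x⟫ = ∑ i, ⟪f' x, e i⟫ * ⟪e i, B x⟫ := fun x =>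
    (e.sum_inner_mul_inner (f' x) (B x)).symm
  simp_rw [h1, h2]
  rw [integral_finsetSum _ fun i _ =>
      PolyGrowth.integrable_of_continuous (by fun_prop) (by fun_prop),
    integral_finsetSum _ fun i _ =>
      PolyGrowth.integrable_of_continuous (by fun_prop) (by fun_prop),
    Finset.sum_mul, ← Finset.sum_add_distrib]
  exact Finset.sum_congr rfl fun i _ => hi i

/-- The case `f = 1` identifies the trace with the mean of `⟪B y, y⟫`, so centring removes the trace
term. -/
theorem integral_mul_inner_apply_self_sub_stdGaussian {f : E → ℝ} {f' : E → E}
    (hf : ∀ x, HasGradientAt f (f' x) x) (hfg : PolyGrowth f) (hf'c : Continuous f')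
    (hf'g : PolyGrowth f') (B : E →L[ℝ] E) :
    ∫ x, f x * (⟪B x, x⟫ - ∫ y, ⟪B y, y⟫ ∂stdGaussian E) ∂stdGaussian E =
      ∫ x, ⟪f' x, B x⟫ ∂stdGaussian E := by
  have hfc : Continuous f := continuous_iff_continuousAt.2 fun x => (hf x).continuousAt
  have hBg : PolyGrowth B := PolyGrowth.of_lipschitzWith B.lipschitz
  have h1 := integral_mul_inner_apply_self_stdGaussian hf hfg hf'c hf'g B
  have h2 := integral_mul_inner_apply_self_stdGaussian (f := fun _ => 1) (f' := fun _ => 0)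
    (fun x => hasGradientAt_const x (1 : ℝ)) (by fun_prop) (by fun_prop) (by fun_prop) B
  simp only [one_mul, inner_zero_left, integral_zero, zero_add, integral_const, probReal_univ,
    one_smul, mul_one] at h2
  simp only [mul_sub]
  rw [integral_sub (PolyGrowth.integrable_of_continuous (by fun_prop) (by fun_prop))
    (PolyGrowth.integrable_of_continuous (by fun_prop) (by fun_prop)), integral_mul_const, h1, h2]
  ring

/-- The Bessel inequality for the projection onto the first two Wiener chaoses. -/
theorem variance_ge_of_hasGradientAt {F : E → ℝ} {F' : E → E}
    (hF : ∀ x, HasGradientAt F (F' x) x) (hFg : PolyGrowth F) (hF'c : Continuous F')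
    (hF'g : PolyGrowth F') (b : E) (B : E →L[ℝ] E) (hB : ∀ x y, ⟪B x, y⟫ = ⟪x, B y⟫) :
    2 * (⟪∫ x, F' x ∂stdGaussian E, b⟫ + ∫ x, ⟪F' x, B x⟫ ∂stdGaussian E) -
      (‖b‖ ^ 2 + 2 * ∫ x, ‖B x‖ ^ 2 ∂stdGaussian E) ≤ Var[F; stdGaussian E] := by
  have hFc : Continuous F := continuous_iff_continuousAt.2 fun x => (hF x).continuousAt
  have hBg : PolyGrowth B := PolyGrowth.of_lipschitzWith B.lipschitz
  set γ := stdGaussian E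
  set c := ∫ y, ⟪B y, y⟫ ∂γ
  -- A general element of the first two chaoses. The inequality is `E (F - E F - q)² ≥ 0`, that is
  -- `Var F ≥ 2 E [F q] - E [q²]`.
  set q : E → ℝ := fun x => ⟪x, b⟫ + (⟪B x, x⟫ - c)
  have hqc : Continuous q := by fun_prop
  have hqg : PolyGrowth q := by fun_prop
  have hq : ∀ {f : E → ℝ} {f' : E → E}, (∀ x, HasGradientAt f (f' x) x) → PolyGrowth f →
      Continuous f' → PolyGrowth f' →
      ∫ x, f x * q x ∂γ = ∫ x, ⟪f' x, b⟫ ∂γ + ∫ x, ⟪f' x, B x⟫ ∂γ := by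
    intro f f' hf hfg hf'c hf'g
    have hfc : Continuous f := continuous_iff_continuousAt.2 fun x => (hf x).continuousAt
    simp only [q, mul_add]
    rw [integral_add (PolyGrowth.integrable_of_continuous (by fun_prop) (by fun_prop))
      (PolyGrowth.integrable_of_continuous (by fun_prop) (by fun_prop)),
      integral_mul_inner_stdGaussian_of_polyGrowth hf hfg hf'c hf'g,
      integral_mul_inner_apply_self_sub_stdGaussian hf hfg hf'c hf'g]
  have hq' : ∀ x, HasGradientAt q (b + (2 : ℝ) • B x) x := by
    intro x
    rw [hasGradientAt_iff_hasFDerivAt]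
    have h1 := ((hasFDerivAt_id x).inner ℝ (hasFDerivAt_const b x)).add
      ((B.hasFDerivAt.inner ℝ (hasFDerivAt_id x)).sub_const c)
    refine h1.congr_fderiv ?_
    ext v
    have h2 : ⟪B v, x⟫ = ⟪B x, v⟫ := by rw [hB, real_inner_comm]
    simp [h2, real_inner_comm, two_mul]
  have h1q : ∫ x, q x ∂γ = 0 := by
    have := hq (f := fun _ => 1) (f' := fun _ => 0) (fun x => hasGradientAt_const x (1 : ℝ))
      (by fun_prop) (by fun_prop) (by fun_prop)
    simpa using this
  have hlin : ∀ w : E, ∫ x, ⟪B x, w⟫ ∂γ = 0 := by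
    intro w
    have h2 := integral_strongDual_stdGaussian (E := E) ((innerSL ℝ w).comp B)
    simpa [real_inner_comm] using h2
  have hqq : ∫ x, q x * q x ∂γ = ‖b‖ ^ 2 + 2 * ∫ x, ‖B x‖ ^ 2 ∂γ := by
    rw [hq hq' hqg (by fun_prop) (by fun_prop)]
    simp only [inner_add_left, inner_smul_left, RCLike.conj_to_real]
    rw [integral_add (PolyGrowth.integrable_of_continuous (by fun_prop) (by fun_prop))
      (PolyGrowth.integrable_of_continuous (by fun_prop) (by fun_prop)),
      integral_add (PolyGrowth.integrable_of_continuous (by fun_prop) (by fun_prop))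
      (PolyGrowth.integrable_of_continuous (by fun_prop) (by fun_prop)), integral_const_mul,
      integral_const_mul, hlin]
    simp only [real_inner_comm (B _) b, hlin, real_inner_self_eq_norm_sq]
    simp [γ]
  have hFq : ∫ x, F x * q x ∂γ = ⟪∫ x, F' x ∂γ, b⟫ + ∫ x, ⟪F' x, B x⟫ ∂γ := by
    rw [hq hF hFg hF'c hF'g]
    congr 1
    have hi : Integrable F' γ := hF'g.integrable_of_continuous hF'c
    rw [real_inner_comm, ← integral_inner hi]
    simp only [real_inner_comm]
  have hpos : 0 ≤ ∫ x, ((F x - ∫ y, F y ∂γ) - q x) ^ 2 ∂γ := integral_nonneg fun x => sq_nonneg _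
  have hexp : ∀ x, ((F x - ∫ y, F y ∂γ) - q x) ^ 2 = (F x - ∫ y, F y ∂γ) ^ 2
      - 2 * (F x * q x) + 2 * (∫ y, F y ∂γ) * q x + q x * q x := fun x => by ring
  simp_rw [hexp] at hpos
  rw [integral_add (PolyGrowth.integrable_of_continuous (by fun_prop) (by fun_prop))
      (PolyGrowth.integrable_of_continuous (by fun_prop) (by fun_prop)),
    integral_add (PolyGrowth.integrable_of_continuous (by fun_prop) (by fun_prop))
      (PolyGrowth.integrable_of_continuous (by fun_prop) (by fun_prop)),
    integral_sub (PolyGrowth.integrable_of_continuous (by fun_prop) (by fun_prop))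
      (PolyGrowth.integrable_of_continuous (by fun_prop) (by fun_prop)),
    integral_const_mul, integral_const_mul, h1q, hqq, hFq] at hpos
  rw [variance_eq_integral hFc.aemeasurable]
  linarith

end Variance

/-! ### The metric projection and the likelihood ratio statistic -/

section Projection

variable {n : ℕ} {K : Set (EuclideanSpace ℝ (Fin n))} {μ₀ : EuclideanSpace ℝ (Fin n)}

theorem inner_sub_metricProj_nonpos (hcl : IsClosed K) (hcv : Convex ℝ K)
    {w : EuclideanSpace ℝ (Fin n)} (hw : w ∈ K) (x : EuclideanSpace ℝ (Fin n)) :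
    ⟪x - metricProj K x, w - metricProj K x⟫ ≤ 0 := by
  obtain ⟨hz, hmin⟩ := metricProj_isArgmin ⟨w, hw⟩ hcl x
  have : Nonempty K := ⟨⟨w, hw⟩⟩
  refine (norm_eq_iInf_iff_real_inner_le_zero hcv hz).1 (le_antisymm ?_ ?_) w hw
  · refine le_ciInf fun ν => ?_
    exact (sq_le_sq₀ (norm_nonneg _) (norm_nonneg _)).1 (hmin ν.2)
  · exact ciInf_le ⟨0, by rintro _ ⟨ν, rfl⟩; exact norm_nonneg _⟩ (⟨_, hz⟩ : K)

/-- The metric projection is firmly nonexpansive. -/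
theorem sq_norm_metricProj_sub_le (hcl : IsClosed K) (hcv : Convex ℝ K) (hne : K.Nonempty)
    (x y : EuclideanSpace ℝ (Fin n)) :
    ‖metricProj K x - metricProj K y‖ ^ 2 ≤ ⟪metricProj K x - metricProj K y, x - y⟫ := by
  have h1 := inner_sub_metricProj_nonpos hcl hcv (metricProj_isArgmin hne hcl y).1 x
  have h2 := inner_sub_metricProj_nonpos hcl hcv (metricProj_isArgmin hne hcl x).1 y
  set a := metricProj K x
  set b := metricProj K y
  have h3 : ⟪a - b, x - y⟫ - ‖a - b‖ ^ 2 = -(⟪x - a, b - a⟫ + ⟪y - b, a - b⟫) := by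
    rw [← real_inner_self_eq_norm_sq]
    simp only [inner_sub_left, inner_sub_right, real_inner_comm]
    ring
  linarith

/-- The displacement from `μ₀` of the projection of `μ₀ + x`. -/
def projDisplacement (K : Set (EuclideanSpace ℝ (Fin n))) (μ₀ x : EuclideanSpace ℝ (Fin n)) :
    EuclideanSpace ℝ (Fin n) :=
  metricProj K (μ₀ + x) - μ₀

theorem sq_norm_projDisplacement_sub_le (hcl : IsClosed K) (hcv : Convex ℝ K) (hμ₀ : μ₀ ∈ K)
    (x y : EuclideanSpace ℝ (Fin n)) :
    ‖projDisplacement K μ₀ x - projDisplacement K μ₀ y‖ ^ 2 ≤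
      ⟪projDisplacement K μ₀ x - projDisplacement K μ₀ y, x - y⟫ := by
  have h := sq_norm_metricProj_sub_le hcl hcv ⟨μ₀, hμ₀⟩ (μ₀ + x) (μ₀ + y)
  simpa [projDisplacement] using h

theorem lipschitzWith_projDisplacement (hcl : IsClosed K) (hcv : Convex ℝ K) (hμ₀ : μ₀ ∈ K) :
    LipschitzWith 1 (projDisplacement K μ₀) := by
  refine LipschitzWith.of_dist_le_mul fun x y => ?_
  rw [dist_eq_norm, dist_eq_norm, NNReal.coe_one, one_mul]
  have h1 := sq_norm_projDisplacement_sub_le hcl hcv hμ₀ x y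
  have h2 := real_inner_le_norm (projDisplacement K μ₀ x - projDisplacement K μ₀ y) (x - y)
  by_contra! h
  nlinarith [norm_nonneg (x - y)]

theorem metricProj_of_mem (hcl : IsClosed K) (hcv : Convex ℝ K) {x : EuclideanSpace ℝ (Fin n)}
    (hx : x ∈ K) : metricProj K x = x :=
  (eq_metricProj hcl hcv hx fun z _ => by simp).symm

theorem sq_norm_projDisplacement_le (hcl : IsClosed K) (hcv : Convex ℝ K) (hμ₀ : μ₀ ∈ K)
    (x : EuclideanSpace ℝ (Fin n)) :
    ‖projDisplacement K μ₀ x‖ ^ 2 ≤ ⟪projDisplacement K μ₀ x, x⟫ := by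
  have h := sq_norm_projDisplacement_sub_le hcl hcv hμ₀ x 0
  have h0 : projDisplacement K μ₀ 0 = 0 := by
    simp [projDisplacement, metricProj_of_mem hcl hcv hμ₀]
  simpa [h0] using h

theorem lrs_add (x : EuclideanSpace ℝ (Fin n)) :
    lrs K μ₀ (μ₀ + x) = ‖x‖ ^ 2 - ‖x - projDisplacement K μ₀ x‖ ^ 2 := by
  have h : μ₀ + x - metricProj K (μ₀ + x) = x - projDisplacement K μ₀ x := by
    rw [projDisplacement]; abel
  rw [lrs, h, add_sub_cancel_left]

theorem polyGrowth_lrs (hcl : IsClosed K) (hcv : Convex ℝ K) (hμ₀ : μ₀ ∈ K) :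
    PolyGrowth fun x => lrs K μ₀ (μ₀ + x) := by
  have := PolyGrowth.of_lipschitzWith (lipschitzWith_projDisplacement hcl hcv hμ₀)
  simp only [lrs_add]
  fun_prop

/-- The projection for `x` is an admissible competitor for `y`, and with it the quadratic terms in
`y` cancel: twice the displacement is a subgradient. -/
theorem two_mul_inner_le_lrs_sub (hcl : IsClosed K) (hμ₀ : μ₀ ∈ K)
    (x y : EuclideanSpace ℝ (Fin n)) :
    2 * ⟪projDisplacement K μ₀ x, y - x⟫ ≤ lrs K μ₀ (μ₀ + y) - lrs K μ₀ (μ₀ + x) := by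
  have h1 : ‖y - projDisplacement K μ₀ y‖ ^ 2 ≤ ‖y - projDisplacement K μ₀ x‖ ^ 2 := by
    have h2 := (metricProj_isArgmin ⟨μ₀, hμ₀⟩ hcl (μ₀ + y)).2
      (metricProj_isArgmin ⟨μ₀, hμ₀⟩ hcl (μ₀ + x)).1
    have h3 : ∀ z, μ₀ + y - z = y - (z - μ₀) := fun z => by abel
    simp only [h3, mem_ofPred_eq] at h2
    exact h2
  rw [lrs_add, lrs_add]
  have h4 := norm_sub_sq_real y (projDisplacement K μ₀ x)
  have h5 := norm_sub_sq_real x (projDisplacement K μ₀ x)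
  rw [inner_sub_right, real_inner_comm y, real_inner_comm x]
  linarith

/-- The subgradient inequalities at `x` and `y` enclose the increment in a gap of at most `2 ‖y -
x‖²`, since the displacement is 1-Lipschitz. -/
theorem hasGradientAt_lrs (hcl : IsClosed K) (hcv : Convex ℝ K) (hμ₀ : μ₀ ∈ K)
    (x : EuclideanSpace ℝ (Fin n)) :
    HasGradientAt (fun x => lrs K μ₀ (μ₀ + x)) ((2 : ℝ) • projDisplacement K μ₀ x) x := by
  rw [hasGradientAt_iff_hasFDerivAt]
  have hb : ∀ y, ‖lrs K μ₀ (μ₀ + y) - lrs K μ₀ (μ₀ + x) -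
      InnerProductSpace.toDual ℝ _ ((2 : ℝ) • projDisplacement K μ₀ x) (y - x)‖ ≤
      2 * ‖‖y - x‖ ^ 2‖ := by
    intro y
    have h1 := two_mul_inner_le_lrs_sub hcl hμ₀ x y
    have h2 := two_mul_inner_le_lrs_sub hcl hμ₀ y x
    have h3 := real_inner_le_norm (projDisplacement K μ₀ y - projDisplacement K μ₀ x) (y - x)
    have h4 := (lipschitzWith_projDisplacement hcl hcv hμ₀).norm_sub_le y x
    rw [NNReal.coe_one, one_mul] at h4
    have h5 : ‖projDisplacement K μ₀ y - projDisplacement K μ₀ x‖ * ‖y - x‖ ≤ ‖y - x‖ ^ 2 := by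
      rw [sq]; gcongr
    rw [inner_sub_left] at h3
    rw [← neg_sub y x, inner_neg_right] at h2
    simp only [InnerProductSpace.toDual_apply_apply, inner_smul_left, RCLike.conj_to_real, norm_pow,
      norm_norm]
    rw [Real.norm_eq_abs, abs_le]
    constructor <;> nlinarith [sq_nonneg ‖y - x‖]
  refine HasFDerivAt.of_isLittleO ?_
  exact (Asymptotics.IsBigO.of_bound 2 (Eventually.of_forall hb)).trans_isLittleO
    (Asymptotics.isLittleO_pow_sub_sub x one_lt_two)

end Projection

/-! ### The expected Jacobian and the variance of the statistic -/

section Jacobian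

variable {n : ℕ} {K : Set (EuclideanSpace ℝ (Fin n))} {μ₀ : EuclideanSpace ℝ (Fin n)}

theorem sq_frobeniusNorm (M : Matrix (Fin n) (Fin n) ℝ) :
    frobeniusNorm M ^ 2 = ∑ i, ∑ j, M i j ^ 2 :=
  sq_sqrt (Finset.sum_nonneg fun _ _ => Finset.sum_nonneg fun _ _ => sq_nonneg _)

/-- Stein's lemma for the Lipschitz coordinates replaces the almost everywhere defined Jacobian by a
continuous integrand. -/
theorem matrixExpectation_jacobian_apply (hcl : IsClosed K) (hcv : Convex ℝ K) (hμ₀ : μ₀ ∈ K)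
    (i j : Fin n) :
    matrixExpectation (stdGaussian (EuclideanSpace ℝ (Fin n)))
      (fun x => jacobian (metricProj K) (μ₀ + x)) i j =
      ∫ x, projDisplacement K μ₀ x i * x j ∂stdGaussian (EuclideanSpace ℝ (Fin n)) := by
  have hp := lipschitzWith_projDisplacement hcl hcv hμ₀
  have hpi : LipschitzWith 1 fun x => projDisplacement K μ₀ x i :=
    LipschitzWith.of_dist_le_mul fun x y => by
      refine le_trans ?_ (hp.dist_le_mul x y)
      rw [dist_eq_norm, dist_eq_norm]
      exact PiLp.norm_apply_le (projDisplacement K μ₀ x - projDisplacement K μ₀ y) i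
  have h := integral_lineDeriv_stdGaussian hpi (EuclideanSpace.single j (1 : ℝ))
  simp only [EuclideanSpace.inner_single_right, conj_trivial, one_mul] at h
  rw [← h]
  simp only [matrixExpectation, jacobian, Matrix.of_apply]
  congr 1 with x
  simp only [lineDeriv, projDisplacement, PiLp.sub_apply, add_assoc, deriv_sub_const_fun]

/-- The Jacobian is half the Hessian of the statistic. A second integration by parts, with `B` of
rank one, moves both derivatives onto the symmetric weight `x j * x i` minus its mean. -/
theorem matrixExpectation_jacobian_symm (hcl : IsClosed K) (hcv : Convex ℝ K) (hμ₀ : μ₀ ∈ K)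
    (i j : Fin n) :
    matrixExpectation (stdGaussian (EuclideanSpace ℝ (Fin n)))
      (fun x => jacobian (metricProj K) (μ₀ + x)) i j =
    matrixExpectation (stdGaussian (EuclideanSpace ℝ (Fin n)))
      (fun x => jacobian (metricProj K) (μ₀ + x)) j i := by
  have hp := lipschitzWith_projDisplacement hcl hcv hμ₀
  have hpc := hp.continuous
  have hpg := PolyGrowth.of_lipschitzWith hp
  have key : ∀ i j : Fin n,
      2 * ∫ x, projDisplacement K μ₀ x i * x j ∂stdGaussian (EuclideanSpace ℝ (Fin n)) =
      ∫ x, lrs K μ₀ (μ₀ + x) * (x j * x i -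
        ∫ y : EuclideanSpace ℝ (Fin n), y j * y i ∂stdGaussian (EuclideanSpace ℝ (Fin n)))
        ∂stdGaussian (EuclideanSpace ℝ (Fin n)) := by
    intro i j
    have h := integral_mul_inner_apply_self_sub_stdGaussian (hasGradientAt_lrs hcl hcv hμ₀)
      (polyGrowth_lrs hcl hcv hμ₀) (by fun_prop) (by fun_prop)
      ((innerSL ℝ (EuclideanSpace.single j (1 : ℝ))).smulRight (EuclideanSpace.single i (1 : ℝ)))
    simp only [ContinuousLinearMap.smulRight_apply, innerSL_apply_apply, inner_smul_left,
      inner_smul_right, EuclideanSpace.inner_single_left, EuclideanSpace.inner_single_right,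
      conj_trivial, one_mul] at h
    rw [h, ← integral_const_mul]
    congr 1 with x
    ring
  rw [matrixExpectation_jacobian_apply hcl hcv hμ₀, matrixExpectation_jacobian_apply hcl hcv hμ₀]
  have h1 := key i j
  have h2 := key j i
  have h3 : ∀ x : EuclideanSpace ℝ (Fin n), x i * x j = x j * x i := fun x => mul_comm _ _
  simp only [h3] at h2
  linarith

theorem integral_sq_norm_toEuclideanCLM (A : Matrix (Fin n) (Fin n) ℝ) :
    ∫ x, ‖Matrix.toEuclideanCLM (𝕜 := ℝ) A x‖ ^ 2 ∂stdGaussian (EuclideanSpace ℝ (Fin n)) =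
      ∑ i, ∑ j, A i j ^ 2 := by
  simp_rw [EuclideanSpace.real_norm_sq_eq, Matrix.ofLp_toEuclideanCLM]
  have h : ∀ (i : Fin n) (x : EuclideanSpace ℝ (Fin n)),
      (A.mulVec (WithLp.ofLp x)) i = innerSL ℝ (WithLp.toLp 2 (A i)) x := by
    intro i x
    simp [Matrix.mulVec, dotProduct, PiLp.inner_apply, mul_comm]
  simp_rw [h]
  rw [integral_finsetSum _ fun i _ => PolyGrowth.integrable_of_continuous
    (PolyGrowth.pow (PolyGrowth.of_lipschitzWith (innerSL ℝ (WithLp.toLp 2 (A i))).lipschitz) 2)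
    (by fun_prop)]
  refine Finset.sum_congr rfl fun i _ => ?_
  rw [integral_sq_strongDual_stdGaussian, innerSL_apply_norm, EuclideanSpace.real_norm_sq_eq]

theorem two_mul_le_variance_lrs (hcl : IsClosed K) (hcv : Convex ℝ K) (hμ₀ : μ₀ ∈ K) :
    2 * (2 * ‖∫ x, projDisplacement K μ₀ x ∂stdGaussian (EuclideanSpace ℝ (Fin n))‖ ^ 2 +
      frobeniusNorm (matrixExpectation (stdGaussian (EuclideanSpace ℝ (Fin n)))
        fun x => jacobian (metricProj K) (μ₀ + x)) ^ 2) ≤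
      Var[fun x => lrs K μ₀ (μ₀ + x); stdGaussian (EuclideanSpace ℝ (Fin n))] := by
  have hp := lipschitzWith_projDisplacement hcl hcv hμ₀
  have hpc := hp.continuous
  have hpg := PolyGrowth.of_lipschitzWith hp
  set A := matrixExpectation (stdGaussian (EuclideanSpace ℝ (Fin n)))
    fun x => jacobian (metricProj K) (μ₀ + x) with hA
  set a := ∫ x, projDisplacement K μ₀ x ∂stdGaussian (EuclideanSpace ℝ (Fin n))
  set B := Matrix.toEuclideanCLM (𝕜 := ℝ) A with hBdef
  have hB : ∀ x y, ⟪B x, y⟫ = ⟪x, B y⟫ := by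
    intro x y
    have hsymm : A.transpose = A := by
      ext i j
      exact matrixExpectation_jacobian_symm hcl hcv hμ₀ j i
    rw [real_inner_comm, Matrix.inner_toEuclideanCLM, Matrix.inner_toEuclideanCLM,
      Matrix.dotProduct_mulVec, ← Matrix.mulVec_transpose, hsymm, dotProduct_comm]
  -- The optimal choices: `b = 2 a` is the expected gradient and `B` half the expected Hessian. The
  -- bound becomes `(8 - 4) ‖a‖² + (4 - 2) ‖A‖_F²`.
  have h := variance_ge_of_hasGradientAt (hasGradientAt_lrs hcl hcv hμ₀)
    (polyGrowth_lrs hcl hcv hμ₀) (by fun_prop) (by fun_prop) ((2 : ℝ) • a) B hB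
  have h1 : ∫ x, ⟪projDisplacement K μ₀ x, B x⟫ ∂stdGaussian (EuclideanSpace ℝ (Fin n)) =
      ∑ i, ∑ j, A i j ^ 2 := by
    have e1 : ∀ x, ⟪projDisplacement K μ₀ x, B x⟫ =
        ∑ i, ∑ j, A i j * (projDisplacement K μ₀ x i * x j) := by
      intro x
      rw [Matrix.inner_toEuclideanCLM]
      simp only [dotProduct, Matrix.mulVec, Finset.mul_sum]
      refine Finset.sum_congr rfl fun i _ => Finset.sum_congr rfl fun j _ => by ring
    have hi : ∀ i j, Integrable (fun x : EuclideanSpace ℝ (Fin n) =>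
        A i j * (projDisplacement K μ₀ x i * x j)) (stdGaussian (EuclideanSpace ℝ (Fin n))) :=
      fun i j => PolyGrowth.integrable_of_continuous (by fun_prop) (by fun_prop)
    simp_rw [e1]
    rw [integral_finsetSum _ fun i _ => integrable_finsetSum _ fun j _ => hi i j]
    refine Finset.sum_congr rfl fun i _ => ?_
    rw [integral_finsetSum _ fun j _ => hi i j]
    refine Finset.sum_congr rfl fun j _ => ?_
    rw [integral_const_mul, ← matrixExpectation_jacobian_apply hcl hcv hμ₀, sq]
  have h2 := integral_sq_norm_toEuclideanCLM A
  rw [← hBdef] at h2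
  simp only [inner_smul_left, inner_smul_right, integral_smul, RCLike.conj_to_real] at h
  rw [integral_const_mul, h1, h2, real_inner_self_eq_norm_sq, norm_smul, Real.norm_ofNat,
    mul_pow] at h
  rw [sq_frobeniusNorm]
  linarith

/-- The displacement is continuous and nonzero at `ν - μ₀` for any other point `ν` of `K`, and the
Gaussian measure charges every nonempty open set. -/
theorem integral_sq_norm_projDisplacement_pos (hcl : IsClosed K) (hcv : Convex ℝ K)
    (hμ₀ : μ₀ ∈ K) (hK : K ≠ {μ₀}) :
    0 < ∫ x, ‖projDisplacement K μ₀ x‖ ^ 2 ∂stdGaussian (EuclideanSpace ℝ (Fin n)) := by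
  have hp := lipschitzWith_projDisplacement hcl hcv hμ₀
  have hpc := hp.continuous
  have hpg := PolyGrowth.of_lipschitzWith hp
  obtain ⟨ν, hν, hne⟩ : ∃ ν ∈ K, ν ≠ μ₀ := by
    by_contra! h
    exact hK (Subset.antisymm (fun x hx => h x hx) (by simpa using hμ₀))
  refine integral_pos_of_integrable_nonneg_nonzero (x := ν - μ₀) (by fun_prop)
    (PolyGrowth.integrable_of_continuous (by fun_prop) (by fun_prop))
    (fun x => by positivity) ?_
  simp [projDisplacement, metricProj_of_mem hcl hcv hν, sub_eq_zero, hne]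

/-- The trace of the expected Jacobian is `E ⟪p, x⟫`, which firm nonexpansiveness bounds below by `E
‖p‖² > 0`. This makes the denominator and `σ` positive. -/
theorem frobeniusNorm_expected_jacobian_pos (hcl : IsClosed K) (hcv : Convex ℝ K)
    (hμ₀ : μ₀ ∈ K) (hK : K ≠ {μ₀}) :
    0 < frobeniusNorm (matrixExpectation (stdGaussian (EuclideanSpace ℝ (Fin n)))
        fun x => jacobian (metricProj K) (μ₀ + x)) ^ 2 := by
  have hp := lipschitzWith_projDisplacement hcl hcv hμ₀
  have hpc := hp.continuous
  have hpg := PolyGrowth.of_lipschitzWith hp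
  rw [sq_frobeniusNorm]
  have hnn : 0 ≤ ∑ i, ∑ j, (matrixExpectation (stdGaussian (EuclideanSpace ℝ (Fin n)))
      fun x => jacobian (metricProj K) (μ₀ + x)) i j ^ 2 :=
    Finset.sum_nonneg fun _ _ => Finset.sum_nonneg fun _ _ => sq_nonneg _
  refine lt_of_le_of_ne hnn fun h0 => ?_
  have hzero : ∀ i, ∫ x, projDisplacement K μ₀ x i * x i
      ∂stdGaussian (EuclideanSpace ℝ (Fin n)) = 0 := by
    intro i
    rw [← matrixExpectation_jacobian_apply hcl hcv hμ₀]
    have h1 := (Finset.sum_eq_zero_iff_of_nonneg fun i _ =>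
      Finset.sum_nonneg fun j _ => sq_nonneg _).1 h0.symm i (Finset.mem_univ i)
    have h2 := (Finset.sum_eq_zero_iff_of_nonneg fun j _ => sq_nonneg _).1 h1 i (Finset.mem_univ i)
    exact pow_eq_zero_iff two_ne_zero |>.1 h2
  have h1 : ∫ x, ⟪projDisplacement K μ₀ x, x⟫ ∂stdGaussian (EuclideanSpace ℝ (Fin n)) = 0 := by
    have e1 : ∀ x, ⟪projDisplacement K μ₀ x, x⟫ = ∑ i, projDisplacement K μ₀ x i * x i := by
      intro x
      simp [PiLp.inner_apply, mul_comm]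
    simp_rw [e1]
    rw [integral_finsetSum _ fun i _ =>
      PolyGrowth.integrable_of_continuous (by fun_prop) (by fun_prop)]
    exact Finset.sum_eq_zero fun i _ => hzero i
  have h2 : ∫ x, ‖projDisplacement K μ₀ x‖ ^ 2 ∂stdGaussian (EuclideanSpace ℝ (Fin n)) ≤
      ∫ x, ⟪projDisplacement K μ₀ x, x⟫ ∂stdGaussian (EuclideanSpace ℝ (Fin n)) :=
    integral_mono (PolyGrowth.integrable_of_continuous (by fun_prop) (by fun_prop))
      (PolyGrowth.integrable_of_continuous (by fun_prop) (by fun_prop))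
      (sq_norm_projDisplacement_le hcl hcv hμ₀)
  linarith [integral_sq_norm_projDisplacement_pos hcl hcv hμ₀ hK]

theorem continuous_metricProj (hcl : IsClosed K) (hcv : Convex ℝ K) (hμ₀ : μ₀ ∈ K) :
    Continuous (metricProj K) := by
  have h : metricProj K = fun y => projDisplacement K μ₀ (y - μ₀) + μ₀ := by
    ext1 y
    simp [projDisplacement]
  have hpc := (lipschitzWith_projDisplacement hcl hcv hμ₀).continuous
  rw [h]
  fun_prop

theorem measurable_jacobian_apply {f : EuclideanSpace ℝ (Fin n) → EuclideanSpace ℝ (Fin n)}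
    (hf : Continuous f) (i j : Fin n) : Measurable fun y => jacobian f y i j := by
  simp only [jacobian, Matrix.of_apply]
  exact measurable_lineDeriv (by fun_prop)

end Jacobian

end LRT

end

/-! ### Transfer to the law of `ξ` and conclusion -/

open LRT in
theorem mainTheorem1 {n : ℕ} (K : Set (EuclideanSpace ℝ (Fin n))) (hKclosed : IsClosed K)
    (hKconvex : Convex ℝ K) (μ₀ : EuclideanSpace ℝ (Fin n)) (hμ₀ : μ₀ ∈ K) (hK : K ≠ {μ₀})
    {Ω : Type*} [MeasurableSpace Ω] (P : Measure Ω) (ξ Y : Ω → EuclideanSpace ℝ (Fin n))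
    (hξ : HasLaw ξ (stdGaussian (EuclideanSpace ℝ (Fin n))) P) (hY : ∀ ω, Y ω = μ₀ + ξ ω)
    (m σ : ℝ) (hm : m = ∫ ω, LRT.lrs K μ₀ (Y ω) ∂P)
    (hσ : σ = √(Var[fun ω => LRT.lrs K μ₀ (Y ω); P])) :
    LRT.tvDist (P.map fun ω => (LRT.lrs K μ₀ (Y ω) - m) / σ) (gaussianReal 0 1) ≤
      8 * √(∫ ω, ‖LRT.metricProj K (Y ω) - μ₀‖ ^ 2 ∂P) /
        (2 * ‖(∫ ω, LRT.metricProj K (Y ω) ∂P) - μ₀‖ ^ 2 +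
          LRT.frobeniusNorm
            (LRT.matrixExpectation P fun ω => LRT.jacobian (LRT.metricProj K) (Y ω)) ^ 2) := by
  have hp := lipschitzWith_projDisplacement hKclosed hKconvex hμ₀
  have hpc := hp.continuous
  have hpg := PolyGrowth.of_lipschitzWith hp
  have hgrad := hasGradientAt_lrs hKclosed hKconvex hμ₀
  have hTg := polyGrowth_lrs hKclosed hKconvex hμ₀
  have hTc : Continuous fun x => lrs K μ₀ (μ₀ + x) :=
    continuous_iff_continuousAt.2 fun x => (hgrad x).continuousAt
  have hprojc := continuous_metricProj hKclosed hKconvex hμ₀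
  set γ := stdGaussian (EuclideanSpace ℝ (Fin n)) with hγ
  have hmean : (∫ ω, metricProj K (Y ω) ∂P) - μ₀ = ∫ x, projDisplacement K μ₀ x ∂γ := by
    have hi : Integrable (fun x => projDisplacement K μ₀ x) γ :=
      hpg.integrable_of_continuous hpc
    have h1 : ∀ x, metricProj K (μ₀ + x) = projDisplacement K μ₀ x + μ₀ := fun x => by
      simp [projDisplacement]
    have h2 := hξ.integral_comp (f := fun x => metricProj K (μ₀ + x))
      (Continuous.aestronglyMeasurable (by fun_prop))
    simp only [Function.comp_def, h1] at h2
    simp only [hY, h1]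
    rw [h2, integral_add hi (integrable_const _)]
    simp [γ]
  have hsq : ∫ ω, ‖metricProj K (Y ω) - μ₀‖ ^ 2 ∂P = ∫ x, ‖projDisplacement K μ₀ x‖ ^ 2 ∂γ := by
    simp only [hY]
    exact hξ.integral_comp (f := fun x => ‖projDisplacement K μ₀ x‖ ^ 2)
      (Continuous.aestronglyMeasurable (by fun_prop))
  have hJ : matrixExpectation P (fun ω => jacobian (metricProj K) (Y ω)) =
      matrixExpectation γ fun x => jacobian (metricProj K) (μ₀ + x) := by
    ext i j
    simp only [matrixExpectation, Matrix.of_apply, hY]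
    exact hξ.integral_comp (f := fun x => jacobian (metricProj K) (μ₀ + x) i j)
      ((measurable_jacobian_apply hprojc i j).comp (measurable_const_add μ₀)).aestronglyMeasurable
  have hm' : m = ∫ x, lrs K μ₀ (μ₀ + x) ∂γ := by
    rw [hm]
    simp only [hY]
    exact hξ.integral_comp (f := fun x => lrs K μ₀ (μ₀ + x)) hTc.aestronglyMeasurable
  have hσ' : σ = √(Var[fun x => lrs K μ₀ (μ₀ + x); γ]) := by
    rw [hσ]
    simp only [hY]
    rw [← hξ.map_eq, variance_map hTc.aemeasurable hξ.aemeasurable]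
    rfl
  have hWm : Measurable fun x => (lrs K μ₀ (μ₀ + x) - m) / σ :=
    (hTc.measurable.sub_const m).div_const σ
  have hmap : (P.map fun ω => (lrs K μ₀ (Y ω) - m) / σ) =
      γ.map fun x => (lrs K μ₀ (μ₀ + x) - m) / σ := by
    simp only [hY, ← hξ.map_eq]
    rw [AEMeasurable.map_map_of_aemeasurable hWm.aemeasurable hξ.aemeasurable]
    rfl
  rw [hmap, hmean, hsq, hJ]
  have hvar := two_mul_le_variance_lrs hKclosed hKconvex hμ₀
  have hpos := frobeniusNorm_expected_jacobian_pos hKclosed hKconvex hμ₀ hK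
  rw [← hγ] at hvar hpos
  set D := 2 * ‖∫ x, projDisplacement K μ₀ x ∂γ‖ ^ 2 +
    frobeniusNorm (matrixExpectation γ fun x => jacobian (metricProj K) (μ₀ + x)) ^ 2
  have hD : 0 < D := by positivity
  have hσ2 : σ ^ 2 = Var[fun x => lrs K μ₀ (μ₀ + x); γ] := by
    rw [hσ', Real.sq_sqrt (variance_nonneg _ _)]
  have hσpos : 0 < σ := by
    rw [hσ']
    exact Real.sqrt_pos.2 (by linarith)
  have : IsProbabilityMeasure (γ.map fun x => (lrs K μ₀ (μ₀ + x) - m) / σ) :=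
    Measure.isProbabilityMeasure_map hWm.aemeasurable
  refine tvDist_le_of_continuous fun h hc h0 h1 => ?_
  rw [integral_map hWm.aemeasurable hc.aestronglyMeasurable, hm']
  refine (abs_integral_sub_integral_gaussianReal_le hp hgrad hTg hσpos hσ2 hc h0 h1).trans ?_
  -- The chaos bound `σ² ≥ 2 D` halves the constant 16.
  calc _ ≤ 16 * √(∫ x, ‖projDisplacement K μ₀ x‖ ^ 2 ∂γ) / (2 * D) := by
        gcongr
        linarith
    _ = 8 * √(∫ x, ‖projDisplacement K μ₀ x‖ ^ 2 ∂γ) / D := by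
        field_simp
        ring
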